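/- Let $m(x)=x(1-x)$ on $(0,1)$. Let $\Omega$ be the set of Radon measures $\omega$ on $(0,1)$ with values in $\{0,1,2,\dots\}\cup\{+\infty\}$ such that $\omega(m):=\int m\,d\omega<+\infty$, endowed with the weakest topology for which $\omega\mapsto\omega(m\phi)$ is continuous for every $\phi\in C_0(0,1)$ (continuous functions on $[0,1]$ vanishing at the endpoints), and let $\mathcal B(\Omega)$ be its Borel $\sigma$-algebra. Let $\mathbf P^0_x$, $x\in(0,1)$, be the law of Brownian motion $X$ on $(0,1)$ started at $x$ and absorbed at the endpoints, i.e. of $x+W$ stopped at its first exit time from $(0,1)$, where $W$ is a standard Brownian motion; let $\tau_a=\inf\{t\ge 0: X(t)=a\}$. For $\omega=\sum_k\delta_{x_k}\in\Omega$ and $t\ge0$ let $P^0_t(\omega,\cdot)$ be the law on $\Omega$ of $\sum_k\delta_{X_k(t)}(\,\cdot\cap(0,1))$, where the $X_k$ are independent with laws $\mathbf P^0_{x_k}$. For $\lambda=(\lambda_0,\lambda_1)$ with $\lambda_0,\lambda_1\ge0$ let $\mu^\lambda_t$ be the measure on $(0,1)$ $$\mu_t^\lambda(dx)=\big[\lambda_0\,\mathbf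 P^0_x(\tau_0\le t)+\lambda_1\,\mathbf P^0_x(\tau_1\le t)\big]\,dx ,$$ let $\Pi_{\mu}$ be the law of the Poisson point process on $(0,1)$ with intensity measure $\mu$, and set $$P_t(\omega,B)=\iint_{\eta_1+\eta_2\in B}\Pi_{\mu_t^\lambda}(d\eta_1)\,P_t^0(\omega,d\eta_2),\qquad t\ge0,\ \omega\in\Omega,\ B\in\mathcal B(\Omega).$$ **Lemma.** For each $\lambda\in[0,\infty)^2$ the family $P_t$, $t\ge0$, is a time-homogeneous Markov transition function on $(\Omega,\mathcal B(\Omega))$. That is: 1. $P_t(\omega,\cdot)$ is a probability measure on $(\Omega,\mathcal B(\Omega))$ for all $t\ge0$, $\omega\in\Omega$, and $P_0(\omega,\cdot)=\delta_\omega$; 2. $(t,\omega)\mapsto P_t(\omega,B)$ is measurable on $[0,\infty)\times\Omega$ for every $B\in\mathcal B(\Omega)$; 3. (Chapman–Kolmogorov) $P_{s+t}(\omega,B)=\int P_s(\omega,d\eta)\,P_t(\eta,B)$ for all $s,t\ge0$, $\omega\in\Omega$, $B\in\mathcal B(\Omega)$. -/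

import Mathlib

open MeasureTheory ProbabilityTheory
open scoped NNReal ENNReal ZeroAtInfty

namespace BrownianGas

noncomputable section

/-! ### Time-homogeneous transition functions -/

/-- A family `P t x` (`t ≥ 0`, `x ∈ E`) of measures on a measurable space `E` is a time-homogeneous
(Markov) transition function: each `P t x` is a probability measure, `P 0 x = δ_x`, the map
`(t, x) ↦ P t x B` is measurable for every measurable `B`, and the Chapman-Kolmogorov equation
holds. -/
structure IsTransitionFunction {E : Type*} [MeasurableSpace E] (P : ℝ≥0 → E → Measure E) :
    Prop where
  isProbabilityMeasure : ∀ t x, IsProbabilityMeasure (P t x)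
  zero : ∀ x, P 0 x = Measure.dirac x
  measurable : ∀ B : Set E, MeasurableSet B → Measurable fun p : ℝ≥0 × E => P p.1 p.2 B
  chapmanKolmogorov : ∀ (s t : ℝ≥0) (x : E) (B : Set E), MeasurableSet B →
    P (s + t) x B = ∫⁻ y, P t y B ∂(P s x)

/-! ### The configuration space -/

/-- The open interval `(0,1)`. -/
abbrev I01 : Type := Set.Ioo (0 : ℝ) 1

/-- The function `m(x) = x (1 - x)` on `(0,1)`. -/
def m (x : I01) : ℝ := (x : ℝ) * (1 - (x : ℝ))

lemma m_nonneg (x : I01) : 0 ≤ m x :=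
  mul_nonneg x.2.1.le (sub_nonneg.2 x.2.2.le)

/-- A measure on `(0,1)` is a tempered configuration if it is a Radon measure with values in
`{0, 1, 2, …} ∪ {+∞}` such that `ω(m) < +∞`. -/
structure IsConfiguration (ω : Measure I01) : Prop where
  radon : ∀ K : Set I01, IsCompact K → ω K < ∞
  integer_valued : ∀ A : Set I01, MeasurableSet A → ∃ n : ℕ∞, ω A = (n : ℝ≥0∞)
  tempered : ∫⁻ x, ENNReal.ofReal (m x) ∂ω < ∞

/-- The space `Ω` of tempered configurations. -/
structure Configuration where
  /-- The configuration as a measure on `(0,1)`. -/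
  toMeasure : Measure I01
  isConfiguration : IsConfiguration toMeasure

namespace Configuration

/-- The weakest topology on `Ω` for which `ω ↦ ω(m φ)` is continuous for every `φ ∈ C₀(0,1)`. -/
instance : TopologicalSpace Configuration :=
  TopologicalSpace.induced
    (fun (ω : Configuration) (φ : C₀(I01, ℝ)) => ∫ x, m x * φ x ∂ω.toMeasure)
    Pi.topologicalSpace

/-- `Ω` carries its Borel σ-algebra. -/
instance : MeasurableSpace Configuration := borel Configuration

instance : BorelSpace Configuration := ⟨rfl⟩

/-- The empty configuration. -/
instance : Zero Configuration where
  zero := ⟨0, fun _ _ => by simp, fun _ _ => ⟨0, by simp⟩, by simp⟩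

/-- The sum (superposition) of two configurations. -/
instance : Add Configuration where
  add ω η := ⟨ω.toMeasure + η.toMeasure,
    fun K hK => by
      simpa using ⟨ω.isConfiguration.radon K hK, η.isConfiguration.radon K hK⟩,
    fun A hA => by
      obtain ⟨a, ha⟩ := ω.isConfiguration.integer_valued A hA
      obtain ⟨b, hb⟩ := η.isConfiguration.integer_valued A hA
      exact ⟨a + b, by simp [ha, hb]⟩,
    by
      rw [lintegral_add_measure]
      exact ENNReal.add_lt_top.2 ⟨ω.isConfiguration.tempered, η.isConfiguration.tempered⟩⟩

open scoped Classical in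
/-- The configuration `∑ᵢ δ_{yᵢ}(· ∩ (0,1))` formed by those points of the family `y` that lie in
`(0,1)`, counted with multiplicity; by convention the empty configuration if these points do not
form a tempered configuration. -/
def ofPoints {ι : Type*} (y : ι → ℝ) : Configuration :=
  if h : IsConfiguration
      ((Measure.sum fun i => Measure.dirac (y i)).comap ((↑) : I01 → ℝ)) then ⟨_, h⟩ else 0

/-- The particles of the configuration `ω`: each position `x ∈ (0,1)` is listed `ω({x})` times,
so that `ω = ∑_{p : ω.Particle} δ_{p.1}`. -/
def Particle (ω : Configuration) : Type :=
  Σ x : I01, Fin ⌊(ω.toMeasure {x}).toReal⌋₊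

/-- The position of a particle. -/
def Particle.pos {ω : Configuration} (p : ω.Particle) : ℝ := (p.1 : ℝ)

end Configuration

/-! ### The Poisson point process -/

/-- The law `Π_μ` of the Poisson point process on `(0,1)` with finite intensity measure `μ`,
as a probability on `Ω`: the number of points is Poisson with parameter `μ(0,1)` and, given that
there are `n` of them, the points are independent with law `μ / μ(0,1)`. That is,
`Π_μ = ∑ₙ e^{-μ(0,1)} / n! · (image of μ^{⊗n} under (x₁, …, xₙ) ↦ δ_{x₁} + … + δ_{xₙ})`. -/
def poissonLaw (μ : Measure I01) [IsFiniteMeasure μ] : Measure Configuration :=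
  Measure.sum fun n : ℕ =>
    ENNReal.ofReal (Real.exp (-μ.real Set.univ) / (n.factorial : ℝ)) •
      (Measure.pi fun _ : Fin n => μ).map
        fun x => Configuration.ofPoints fun i => (x i : ℝ)

/-! ### Absorbed Brownian motion -/

section Dynamics

variable {S : Type*}

/-- The Brownian motion `x + W` absorbed at the endpoints of `(0,1)`: the path is stopped at the
first time at which it is outside `(0,1)`. -/
def absorbed (W : ℝ≥0 → S → ℝ) (x : ℝ) : ℝ≥0 → S → ℝ :=
  stoppedProcess (fun t s => x + W t s)
    (hittingAfter (fun t s => x + W t s) (Set.Ioo (0 : ℝ) 1)ᶜ 0)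

/-- The hitting time `τ_a = inf {t ≥ 0 : X(t) = a}` (with `inf ∅ = +∞`) of `a ∈ [0,1]` by the
absorbed Brownian motion `X` started at `x`. -/
def hitTime (W : ℝ≥0 → S → ℝ) (x a : ℝ) : S → WithTop ℝ≥0 :=
  hittingAfter (absorbed W x) {a} 0

variable [MeasurableSpace S]

/-- The law `P_t^0(ω, ·)` at time `t` of independent Brownian motions on `(0,1)` with absorption
at the endpoints, one started from each particle of `ω` (each driven by its own independent copy
of `W`); only the particles that are in `(0,1)` at time `t` are recorded. -/
def freeLaw (Pr : Measure S) (W : ℝ≥0 → S → ℝ) (t : ℝ≥0) (ω : Configuration) :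
    Measure Configuration :=
  (Measure.infinitePi fun _ : ω.Particle => Pr).map
    fun w => Configuration.ofPoints fun p : ω.Particle => absorbed W p.pos t (w p)

/-- The measure `μ_t^λ(dx) = [λ₀ P_x(τ₀ ≤ t) + λ₁ P_x(τ₁ ≤ t)] dx` on `(0,1)`. -/
def injection (Pr : Measure S) (W : ℝ≥0 → S → ℝ) (lam₀ lam₁ : ℝ≥0) (t : ℝ≥0) : Measure I01 :=
  ((volume : Measure ℝ).comap ((↑) : I01 → ℝ)).withDensity fun x =>
    lam₀ * Pr {s | hitTime W x 0 s ≤ (t : WithTop ℝ≥0)} +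
      lam₁ * Pr {s | hitTime W x 1 s ≤ (t : WithTop ℝ≥0)}

instance (Pr : Measure S) [IsProbabilityMeasure Pr] (W : ℝ≥0 → S → ℝ) (lam₀ lam₁ : ℝ≥0) (t : ℝ≥0) :
    IsFiniteMeasure (injection Pr W lam₀ lam₁ t) := by
  refine isFiniteMeasure_withDensity (ne_top_of_le_ne_top ?_
    (lintegral_mono (g := fun _ => (lam₀ + lam₁ : ℝ≥0∞)) fun x => ?_))
  · have h : (volume : Measure ℝ).comap ((↑) : I01 → ℝ) Set.univ ≠ ∞ := by
      rw [comap_subtype_coe_apply measurableSet_Ioo, Set.image_univ, Subtype.range_coe]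
      exact measure_Ioo_lt_top.ne
    simpa using ENNReal.mul_ne_top (by simp) h
  · exact add_le_add (mul_le_of_le_one_right' prob_le_one)
      (mul_le_of_le_one_right' prob_le_one)

/-- The law `P_t(ω, ·)` of the boundary driven Brownian gas at time `t` started from `ω`, i.e.
`P_t(ω, B) = ∬_{η₁ + η₂ ∈ B} Π_{μ_t^λ}(dη₁) P_t^0(ω, dη₂)`. -/
def gasLaw (Pr : Measure S) [IsProbabilityMeasure Pr] (W : ℝ≥0 → S → ℝ) (lam₀ lam₁ : ℝ≥0)
    (t : ℝ≥0) (ω : Configuration) : Measure Configuration :=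
  ((poissonLaw (injection Pr W lam₀ lam₁ t)).prod (freeLaw Pr W t ω)).map
    fun η => η.1 + η.2

end Dynamics

end

end BrownianGas

namespace BrownianGas

open Filter Topology

/-! ### The Borel σ-algebra of the configuration space -/

/-! Everything is tested on Laplace functionals `E e^{-η(g)}`, with `g : (0,1) → [0,∞]` measurable.
The Borel σ-algebra of `Ω` is the one generated by the counting maps
(`measurableSpace_eq_countingSigma`). Hence a probability on `Ω` is determined by its Laplace
functional (`ext_of_laplace`), and a family of probabilities is measurable in its parameter as soon
as its Laplace functionals are (`measurable_of_laplace`).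

Let `T` be the semigroup of absorbed Brownian motion, `Q` that of Brownian motion killed outside
`(0,1)`, and `V_t g = -log T_t e^{-g}`, with `g = 0` off `(0,1)`. Independence of the particles and
the exponential formula for the Poisson process give (`lintegral_laplaceVar_gasLaw`) `∫ e^{-η(g)}
P_t(ω, dη) = exp(-μ_t(1 - e^{-g})) · e^{-ω(V_t g)}`. Joint measurability and the value at `t = 0`
are read off this formula. Chapman-Kolmogorov reduces to three identities: `V_{s+t} = V_s V_t`,
which is the Markov property of the absorbed motion; `1 - e^{-V_t g} = Q_t(1 - e^{-g})`; `μ_{s+t}(f)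
= μ_s(f) + μ_t(Q_s f)`. For the last one, a path absorbed at an endpoint by time `s + t` is either
absorbed by time `s`, or survives until `s` and is absorbed during the next `t` units of time.
Symmetry of `Q_s` with respect to Lebesgue measure, obtained by time reversal, then moves `Q_s` onto
`f`.

It must also be shown that the particles alive at time `t` almost surely form a tempered
configuration. The function `sin(πx)` is comparable to `m` and excessive for `Q`, so `Q_t m ≤ 2π m`
and the expected total weight is at most `2π ω(m)`. Since `W` is Brownian only up to null sets, it
is first replaced by an indistinguishable process that is everywhere continuous, measurable and null
at time `0`. -/

lemma m_pos (x : I01) : 0 < m x := mul_pos x.2.1 (sub_pos.2 x.2.2)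

@[fun_prop]
lemma continuous_m : Continuous m := by unfold m; fun_prop

lemma continuous_ofReal_m : Continuous fun x : I01 => ENNReal.ofReal (m x) :=
  ENNReal.continuous_ofReal.comp continuous_m

/-- The extension by zero of a function on `(0,1)` vanishing at the endpoints is continuous. -/
lemma continuous_extend_zero (f : C₀(I01, ℝ)) :
    Continuous (Function.extend ((↑) : I01 → ℝ) f 0) := by
  have hemb : IsOpenEmbedding ((↑) : I01 → ℝ) := isOpen_Ioo.isOpenEmbedding_subtypeVal
  rw [continuous_iff_continuousAt]
  intro x
  by_cases hx : x ∈ Set.Ioo (0 : ℝ) 1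
  · have : ContinuousAt (Function.extend ((↑) : I01 → ℝ) f 0 ∘ ((↑) : I01 → ℝ)) ⟨x, hx⟩ := by
      rw [show Function.extend ((↑) : I01 → ℝ) f 0 ∘ ((↑) : I01 → ℝ) = f from
        funext fun y => Subtype.val_injective.extend_apply f 0 y]
      exact f.continuous.continuousAt
    exact (hemb.continuousAt_iff (x := ⟨x, hx⟩)).1 this
  · have h0 : Function.extend ((↑) : I01 → ℝ) f 0 x = 0 := by
      rw [Function.extend_apply', Pi.zero_apply]
      rintro ⟨a, rfl⟩
      exact hx a.2
    rw [ContinuousAt, h0, Metric.tendsto_nhds]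
    intro ε hε
    have h := (Metric.tendsto_nhds.1 (zero_at_infty f)) ε hε
    obtain ⟨K, hK, hKs⟩ := Filter.mem_cocompact.1 h
    have hK' : IsClosed (((↑) : I01 → ℝ) '' K) := (hK.image continuous_subtype_val).isClosed
    have hxK : x ∉ ((↑) : I01 → ℝ) '' K := by
      rintro ⟨a, -, rfl⟩
      exact hx a.2
    filter_upwards [hK'.isOpen_compl.mem_nhds hxK] with y hy
    by_cases hy' : y ∈ Set.Ioo (0 : ℝ) 1
    · have : Function.extend ((↑) : I01 → ℝ) f 0 y = f ⟨y, hy'⟩ :=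
        Subtype.val_injective.extend_apply f 0 ⟨y, hy'⟩
      rw [this]
      exact hKs fun hk => hy ⟨_, hk, rfl⟩
    · rw [Function.extend_apply', Pi.zero_apply, dist_self]
      · exact hε
      · rintro ⟨a, rfl⟩
        exact hy' a.2

/-- Extension by zero embeds `C₀(0,1)` isometrically into the second countable space `C([0,1])`. -/
instance : TopologicalSpace.SeparableSpace C₀(I01, ℝ) := by
  let E : C₀(I01, ℝ) → C(Set.Icc (0 : ℝ) 1, ℝ) := fun f =>
    ⟨fun x => Function.extend ((↑) : I01 → ℝ) f 0 x,
      (continuous_extend_zero f).comp continuous_subtype_val⟩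
  have hE : Isometry E := by
    refine Isometry.of_dist_eq fun f g => le_antisymm ?_ ?_
    · rw [ContinuousMap.dist_le dist_nonneg]
      intro x
      by_cases hx : (x : ℝ) ∈ Set.Ioo (0 : ℝ) 1
      · have h (f : C₀(I01, ℝ)) : E f x = f ⟨x, hx⟩ :=
          Subtype.val_injective.extend_apply f 0 ⟨x, hx⟩
        rw [h, h]
        exact BoundedContinuousFunction.dist_coe_le_dist (f := f.toBCF) (g := g.toBCF) _
      · have h (f : C₀(I01, ℝ)) : E f x = 0 := by
          change Function.extend ((↑) : I01 → ℝ) f 0 x = 0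
          rw [Function.extend_apply', Pi.zero_apply]
          rintro ⟨a, ha⟩
          exact hx (ha ▸ a.2)
        rw [h, h, dist_self]
        exact dist_nonneg
    · change dist f.toBCF g.toBCF ≤ _
      rw [BoundedContinuousFunction.dist_le dist_nonneg]
      intro x
      have h (f : C₀(I01, ℝ)) : f x = E f ⟨x, x.2.1.le, x.2.2.le⟩ :=
        (Subtype.val_injective.extend_apply f 0 x).symm
      change dist (f x) (g x) ≤ _
      rw [h, h]
      exact ContinuousMap.dist_apply_le_dist _
  have := hE.isEmbedding.secondCountableTopology
  infer_instance

namespace Configuration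

/-- The finite measure `m ω` associated with a configuration `ω`. -/
noncomputable def weighted (ω : Configuration) : Measure I01 :=
  ω.toMeasure.withDensity fun x => ENNReal.ofReal (m x)

lemma weighted_univ (ω : Configuration) :
    ω.weighted Set.univ = ∫⁻ x, ENNReal.ofReal (m x) ∂ω.toMeasure := by
  simp [weighted]

instance (ω : Configuration) : IsFiniteMeasure ω.weighted :=
  ⟨by rw [weighted_univ]; exact ω.isConfiguration.tempered⟩

lemma integral_m_mul (ω : Configuration) (φ : I01 → ℝ) :
    ∫ x, m x * φ x ∂ω.toMeasure = ∫ x, φ x ∂ω.weighted := by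
  rw [weighted, integral_withDensity_eq_integral_toReal_smul
    continuous_ofReal_m.measurable (by simp)]
  simp [ENNReal.toReal_ofReal (m_nonneg _)]

/-- Since `m > 0`, the possibly infinite measure `ω` is recovered from the finite measure `m ω`, to
which limit theorems and kernel results apply. -/
lemma lintegral_eq_weighted (ω : Configuration) {f : I01 → ℝ≥0∞} (hf : Measurable f) :
    ∫⁻ x, f x ∂ω.toMeasure = ∫⁻ x, (ENNReal.ofReal (m x))⁻¹ * f x ∂ω.weighted := by
  have hm := continuous_ofReal_m.measurable
  rw [weighted, lintegral_withDensity_eq_lintegral_mul (g := fun x => (ENNReal.ofReal (m x))⁻¹ * f x) _ hm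
      (hm.inv.mul hf)]
  refine lintegral_congr fun x => ?_
  rw [Pi.mul_apply, ← mul_assoc, ENNReal.mul_inv_cancel, one_mul]
  · simpa using m_pos x
  · simp

lemma integrable_weighted (ω : Configuration) (φ : C₀(I01, ℝ)) : Integrable φ ω.weighted :=
  φ.toBCF.integrable _

/-- The σ-algebra generated by the counting maps `ω ↦ ω(A)`. -/
abbrev countingSigma : MeasurableSpace Configuration :=
  MeasurableSpace.comap toMeasure Measure.instMeasurableSpace

lemma measurable_weighted_countingSigma : Measurable[countingSigma] weighted := by
  refine Measure.measurable_of_measurable_coe _ fun s hs => ?_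
  have h : (fun ω : Configuration => ω.weighted s) =
      (fun μ : Measure I01 => ∫⁻ x, s.indicator (fun x => ENNReal.ofReal (m x)) x ∂μ) ∘
        toMeasure := by
    ext ω
    rw [weighted, withDensity_apply _ hs, Function.comp_apply, lintegral_indicator hs]
  rw [h]
  exact (Measure.measurable_lintegral (continuous_ofReal_m.measurable.indicator hs)).comp
    (comap_measurable _)

lemma measurable_integral_countingSigma (φ : C₀(I01, ℝ)) :
    Measurable[countingSigma] fun ω : Configuration => ∫ x, m x * φ x ∂ω.toMeasure := by
  have h : (fun ω : Configuration => ∫ x, m x * φ x ∂ω.toMeasure) = fun ω : Configuration =>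
      (∫⁻ x, ENNReal.ofReal (φ x) ∂ω.weighted).toReal -
        (∫⁻ x, ENNReal.ofReal (-φ x) ∂ω.weighted).toReal := by
    ext ω
    rw [integral_m_mul, integral_eq_lintegral_pos_part_sub_lintegral_neg_part
      (ω.integrable_weighted φ)]
  rw [h]
  have hφ := φ.continuous.measurable
  exact ((Measure.measurable_lintegral hφ.ennreal_ofReal).comp
      measurable_weighted_countingSigma).ennreal_toReal.sub
    ((Measure.measurable_lintegral hφ.neg.ennreal_ofReal).comp
      measurable_weighted_countingSigma).ennreal_toReal

lemma abs_integral_sub_le (ω : Configuration) (φ ψ : C₀(I01, ℝ)) :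
    |∫ x, m x * φ x ∂ω.toMeasure - ∫ x, m x * ψ x ∂ω.toMeasure| ≤
      dist φ ψ * ω.weighted.real Set.univ := by
  rw [integral_m_mul, integral_m_mul,
    ← integral_sub (ω.integrable_weighted φ) (ω.integrable_weighted ψ), ← Real.norm_eq_abs]
  refine norm_integral_le_of_norm_le_const (ae_of_all _ fun x => ?_)
  rw [← dist_eq_norm]
  exact BoundedContinuousFunction.dist_coe_le_dist (f := φ.toBCF) (g := ψ.toBCF) x

/-- The topology is defined by uncountably many functionals, so an open set need not be a countable
combination of basic ones at first sight. On the set where `ω(m) ≤ n`, however, `φ ↦ ω(mφ)` is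
`n`-Lipschitz, so each functional is a uniform limit of those indexed by a countable dense set `D`.
The trace of an open set on this piece is thus cut out by countably many measurable functionals, and
the pieces exhaust `Ω`. -/
lemma borel_le_countingSigma : borel Configuration ≤ countingSigma := by
  refine MeasurableSpace.generateFrom_le fun U hU => ?_
  obtain ⟨D, hDc, hDd⟩ := TopologicalSpace.exists_countable_dense C₀(I01, ℝ)
  have : Countable D := hDc.to_subtype
  let e (φ : C₀(I01, ℝ)) (ω : Configuration) : ℝ := ∫ x, m x * φ x ∂ω.toMeasure
  let Ω (n : ℕ) : Set Configuration := {ω | ω.weighted.real Set.univ ≤ n}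
  let F (ω : Configuration) : D → ℝ := fun φ => e φ ω
  have hΩ (n : ℕ) : MeasurableSet[countingSigma] (Ω n) := by
    have : Measurable[countingSigma] fun ω : Configuration => ω.weighted.real Set.univ :=
      ((Measure.measurable_coe MeasurableSet.univ).comp
        measurable_weighted_countingSigma).ennreal_toReal
    exact this measurableSet_Iic
  have hF : Measurable[countingSigma] F :=
    @measurable_pi_lambda _ _ _ countingSigma _ _ fun φ => measurable_integral_countingSigma φ
  have key (n : ℕ) : ∃ V : Set (D → ℝ), IsOpen V ∧ U ∩ Ω n = F ⁻¹' V ∩ Ω n := by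
    -- The piece `Ω n` is given the topology induced by the functionals of `D` alone; it remains to
    -- see that all the others are continuous for it.
    let τ : TopologicalSpace (Ω n) := TopologicalSpace.induced (fun ω : Ω n => F ω)
      Pi.topologicalSpace
    have hFc : Continuous fun ω : Ω n => F ω := continuous_induced_dom
    have hcont : Continuous fun (ω : Ω n) (φ : C₀(I01, ℝ)) => e φ ω := by
      refine continuous_pi fun φ => continuous_of_uniform_approx_of_continuous ?_
      intro u hu
      obtain ⟨ε, hε, hεu⟩ := Metric.mem_uniformity_dist.1 hu
      obtain ⟨ψ, hψ, hd⟩ := Metric.dense_iff.1 hDd φ (ε / (n + 1)) (by positivity)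
      refine ⟨fun ω => e ψ ω, (continuous_apply (⟨ψ, hd⟩ : D)).comp hFc, fun ω => hεu ?_⟩
      rw [Real.dist_eq]
      refine (abs_integral_sub_le ω.1 φ ψ).trans_lt ?_
      have h1 : dist φ ψ < ε / (n + 1) := by
        rw [dist_comm]; exact hψ
      have h2 : ω.1.weighted.real Set.univ ≤ n := ω.2
      calc dist φ ψ * ω.1.weighted.real Set.univ ≤ dist φ ψ * n := by gcongr
        _ ≤ ε / (n + 1) * n := by gcongr
        _ < ε := by
          rw [div_mul_eq_mul_div, div_lt_iff₀ (by positivity)]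
          nlinarith
    obtain ⟨V, hV, rfl⟩ := isOpen_induced_iff.1 hU
    obtain ⟨V', hV', h⟩ := isOpen_induced_iff.1 (hV.preimage hcont)
    refine ⟨V', hV', Set.ext fun ω => ?_⟩
    by_cases hω : ω ∈ Ω n
    · have := Set.ext_iff.1 h ⟨ω, hω⟩
      simp only [Set.mem_inter_iff, hω, and_true]
      exact this.symm
    · simp [hω]
  choose V hV hUV using key
  have hU' : U = ⋃ n, F ⁻¹' (V n) ∩ Ω n := by
    simp_rw [← hUV, ← Set.inter_iUnion]
    refine (Set.inter_eq_left.2 fun ω _ => Set.mem_iUnion.2 ?_).symm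
    exact exists_nat_ge (ω.weighted.real Set.univ)
  rw [hU']
  exact MeasurableSet.iUnion fun n => (hF (hV n).measurableSet).inter (hΩ n)

end Configuration
end BrownianGas

namespace BrownianGas

open Filter Topology

/-! ### Borel measurability of the counting maps. -/

lemma min_le_two_mul_m (x : I01) : min (x : ℝ) (1 - x) ≤ 2 * m x := by
  obtain ⟨h0, h1⟩ := x.2
  unfold m
  rcases le_total (x : ℝ) (1 - x) with h | h
  · rw [min_eq_left h]; nlinarith
  · rw [min_eq_right h]; nlinarith

lemma isCompact_preimage_Icc {δ : ℝ} (hδ : 0 < δ) :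
    IsCompact (((↑) : I01 → ℝ) ⁻¹' Set.Icc δ (1 - δ)) := by
  rw [Subtype.isCompact_iff, Subtype.image_preimage_coe, Set.inter_eq_right.2]
  · exact isCompact_Icc
  · exact fun x hx => ⟨hδ.trans_le hx.1, hx.2.trans_lt (by linarith)⟩

/-- A continuous function dominated by the distance to the boundary, as an element of `C₀`. -/
noncomputable def C0OfLe (f : C(I01, ℝ)) (k : ℝ) (h : ∀ x, |f x| ≤ k * min (x : ℝ) (1 - x)) :
    C₀(I01, ℝ) where
  toContinuousMap := f
  zero_at_infty' := by
    rw [Metric.tendsto_nhds]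
    intro ε hε
    refine Filter.mem_cocompact.2 ⟨_, isCompact_preimage_Icc
      (δ := ε / (|k| + 1)) (by positivity), fun x hx => ?_⟩
    simp only [Set.mem_compl_iff, Set.mem_preimage, Set.mem_Icc, not_and_or, not_le] at hx
    have hlt : min (x : ℝ) (1 - x) < ε / (|k| + 1) := by
      rcases hx with hx | hx
      · exact (min_le_left _ _).trans_lt hx
      · exact (min_le_right _ _).trans_lt (by linarith)
    have hmin : 0 ≤ min (x : ℝ) (1 - x) := le_min x.2.1.le (sub_nonneg.2 x.2.2.le)
    have hk := le_abs_self k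
    change dist (f x) 0 < ε
    rw [dist_zero_right, Real.norm_eq_abs]
    rw [lt_div_iff₀ (by positivity)] at hlt
    nlinarith [h x]

namespace Configuration

/-- The indicator of `U` is the pointwise limit of `min(1, k d)`, where `d` is the distance to the
complement of `U` in `ℝ`. That complement contains `0` and `1`, so `d` is at most the distance to
the boundary and these functions lie in `C₀`; their integrals are continuous in `ω` by definition of
the topology. -/
lemma measurable_weighted_open {U : Set I01} (hU : IsOpen U) :
    Measurable fun ω : Configuration => ω.weighted U := by
  let V : Set ℝ := ((↑) : I01 → ℝ) '' U
  have hV : IsOpen V := isOpen_Ioo.isOpenMap_subtype_val U hU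
  have hne : Vᶜ.Nonempty := ⟨0, by rintro ⟨x, -, hx⟩; exact x.2.1.ne' hx⟩
  let d (x : I01) : ℝ := Metric.infDist (x : ℝ) Vᶜ
  have hdc : Continuous d := (Metric.continuous_infDist_pt _).comp continuous_subtype_val
  have hd (x : I01) : d x ≤ min (x : ℝ) (1 - x) := by
    refine le_min ?_ ?_
    · have h : (0 : ℝ) ∈ Vᶜ := by rintro ⟨x, -, hx⟩; exact x.2.1.ne' hx
      simpa [Real.dist_eq, abs_of_pos x.2.1] using Metric.infDist_le_dist_of_mem (x := (x : ℝ)) h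
    · have h : (1 : ℝ) ∈ Vᶜ := by rintro ⟨x, -, hx⟩; exact x.2.2.ne hx
      have := Metric.infDist_le_dist_of_mem (x := (x : ℝ)) h
      rwa [Real.dist_eq, abs_sub_comm, abs_of_pos (sub_pos.2 x.2.2)] at this
  let φ (k : ℕ) : C₀(I01, ℝ) := C0OfLe ⟨fun x => min 1 (k * d x), by fun_prop⟩ k fun x => by
    have h0 : 0 ≤ d x := Metric.infDist_nonneg
    have h1 : 0 ≤ min 1 (k * d x) := le_min zero_le_one (by positivity)
    simp only [ContinuousMap.coe_mk]
    rw [abs_of_nonneg h1]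
    exact (min_le_right _ _).trans (by gcongr; exact hd x)
  have hφ (k : ℕ) (x : I01) : φ k x = min 1 (k * d x) := rfl
  have hφm (k : ℕ) : Measurable fun ω : Configuration => ∫⁻ x, ENNReal.ofReal (φ k x) ∂ω.weighted := by
    have h (ω : Configuration) : ∫⁻ x, ENNReal.ofReal (φ k x) ∂ω.weighted =
        ENNReal.ofReal (∫ x, m x * φ k x ∂ω.toMeasure) := by
      rw [integral_m_mul, ofReal_integral_eq_lintegral_ofReal (ω.integrable_weighted _)]
      exact ae_of_all _ fun x => le_min zero_le_one
        (mul_nonneg (Nat.cast_nonneg _) Metric.infDist_nonneg)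
    simp_rw [h]
    refine Measurable.ennreal_ofReal (Continuous.measurable ?_)
    have hc : Continuous fun (ω : Configuration) (φ : C₀(I01, ℝ)) =>
      ∫ x, m x * φ x ∂ω.toMeasure := continuous_induced_dom
    exact continuous_pi_iff.1 hc (φ k)
  refine measurable_of_tendsto_metrizable hφm (tendsto_pi_nhds.2 fun ω => ?_)
  rw [← lintegral_indicator_one hU.measurableSet]
  refine tendsto_lintegral_of_dominated_convergence (fun _ => 1)
    (fun k => (φ k).continuous.measurable.ennreal_ofReal)
    (fun k => ae_of_all _ fun x => ?_) (by simp) (ae_of_all _ fun x => ?_)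
  · beta_reduce
    rw [hφ, ← ENNReal.ofReal_one]
    exact ENNReal.ofReal_le_ofReal (min_le_left _ _)
  · by_cases hx : x ∈ U
    · have hpos : 0 < d x := by
        refine (hV.isClosed_compl.notMem_iff_infDist_pos hne).1 ?_
        exact fun h => h ⟨x, hx, rfl⟩
      rw [Set.indicator_of_mem hx]
      refine tendsto_const_nhds.congr' ?_
      obtain ⟨n, hn⟩ := exists_nat_gt (1 / d x)
      filter_upwards [eventually_ge_atTop n] with k hk
      have : 1 ≤ k * d x := by
        rw [div_lt_iff₀ hpos] at hn
        have : (n : ℝ) ≤ k := by exact_mod_cast hk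
        nlinarith
      rw [hφ, min_eq_left this]
      simp
    · have hz : d x = 0 := by
        refine Metric.infDist_zero_of_mem ?_
        rintro ⟨y, hy, hyx⟩
        exact hx (Subtype.ext hyx ▸ hy)
      simp [hφ, hz, hx]

lemma measurable_weighted : Measurable weighted :=
  .measure_of_isPiSystem (BorelSpace.measurable_eq.trans rfl) isPiSystem_isOpen
    (fun _ hU => measurable_weighted_open hU) (measurable_weighted_open isOpen_univ)

lemma measurable_toMeasure : Measurable toMeasure := by
  refine Measure.measurable_of_measurable_coe _ fun s hs => ?_
  have h (ω : Configuration) : ω.toMeasure s =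
      ∫⁻ x, (ENNReal.ofReal (m x))⁻¹ * s.indicator 1 x ∂ω.weighted := by
    rw [← lintegral_eq_weighted _ (measurable_one.indicator hs), lintegral_indicator_one hs]
  simp_rw [h]
  exact (Measure.measurable_lintegral (continuous_ofReal_m.measurable.inv.mul
    (measurable_one.indicator hs))).comp measurable_weighted

lemma measurableSpace_eq_countingSigma :
    (inferInstance : MeasurableSpace Configuration) = countingSigma :=
  le_antisymm borel_le_countingSigma measurable_toMeasure.comap_le

lemma measurable_iff_toMeasure {X : Type*} [MeasurableSpace X] {f : X → Configuration} :
    Measurable f ↔ Measurable fun x => (f x).toMeasure := by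
  refine ⟨fun h => measurable_toMeasure.comp h, fun h => ?_⟩
  rw [measurable_iff_comap_le]
  change MeasurableSpace.comap f (inferInstance : MeasurableSpace Configuration) ≤ _
  rw [measurableSpace_eq_countingSigma, MeasurableSpace.comap_comp]
  exact h.comap_le

lemma measurable_lintegral_toMeasure {f : I01 → ℝ≥0∞} (hf : Measurable f) :
    Measurable fun ω : Configuration => ∫⁻ x, f x ∂ω.toMeasure :=
  (Measure.measurable_lintegral hf).comp measurable_toMeasure

@[simp]
lemma toMeasure_add (ω η : Configuration) : (ω + η).toMeasure = ω.toMeasure + η.toMeasure := rfl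

@[simp]
lemma toMeasure_zero : (0 : Configuration).toMeasure = 0 := rfl

lemma measurable_add : Measurable fun p : Configuration × Configuration => p.1 + p.2 := by
  refine measurable_iff_toMeasure.2 (Measure.measurable_of_measurable_coe _ fun s hs => ?_)
  simp only [toMeasure_add, Measure.add_apply]
  exact ((Measure.measurable_coe hs).comp (measurable_toMeasure.comp measurable_fst)).add
    ((Measure.measurable_coe hs).comp (measurable_toMeasure.comp measurable_snd))

/-- Joint measurability of `(a, ω) ↦ ∫ f(a, x) ω(dx)`. -/
lemma measurable_lintegral_param {A : Type*} [MeasurableSpace A] {f : A → I01 → ℝ≥0∞}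
    (hf : Measurable (Function.uncurry f)) :
    Measurable fun p : A × Configuration => ∫⁻ x, f p.1 x ∂p.2.toMeasure := by
  let mass (ω : Configuration) : ℝ≥0∞ := ω.weighted Set.univ
  have hmass : Measurable mass := (Measure.measurable_coe .univ).comp measurable_weighted
  have hfin (ω : Configuration) : mass ω ≠ ∞ := measure_ne_top _ _
  -- The masses `ω(m)` are not uniformly bounded; normalizing makes a finite kernel. When the mass
  -- vanishes, `∞ • 0 = 0` does no harm.
  let κ : Kernel (A × Configuration) I01 := ⟨fun p => (mass p.2)⁻¹ • p.2.weighted, by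
    refine Measure.measurable_of_measurable_coe _ fun s hs => ?_
    simp only [Measure.smul_apply, smul_eq_mul]
    exact (hmass.comp measurable_snd).inv.mul
      (((Measure.measurable_coe hs).comp measurable_weighted).comp measurable_snd)⟩
  have : IsFiniteKernel κ := ⟨1, ENNReal.one_lt_top, fun p => by
    change (mass p.2)⁻¹ * mass p.2 ≤ 1
    exact ENNReal.inv_mul_le_one _⟩
  have h (p : A × Configuration) : ∫⁻ x, f p.1 x ∂p.2.toMeasure =
      mass p.2 * ∫⁻ x, (ENNReal.ofReal (m x))⁻¹ * f p.1 x ∂κ p := by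
    rw [lintegral_eq_weighted (f := f p.1) _ (hf.comp measurable_prodMk_left)]
    change _ = _ * ∫⁻ x, _ ∂((mass p.2)⁻¹ • p.2.weighted)
    rw [lintegral_smul_measure, smul_eq_mul, ← mul_assoc]
    rcases eq_or_ne (mass p.2) 0 with h0 | h0
    · rw [h0, Measure.measure_univ_eq_zero.1 h0]
      simp
    · rw [ENNReal.mul_inv_cancel h0 (hfin _), one_mul]
  simp_rw [h]
  refine (hmass.comp measurable_snd).mul (Measurable.lintegral_kernel_prod_right (κ := κ) ?_)
  exact (continuous_ofReal_m.measurable.inv.comp measurable_snd).mul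
    (hf.comp (measurable_fst.fst.prodMk measurable_snd))

end Configuration
end BrownianGas

namespace BrownianGas

open Filter Topology

/-! ### Laplace functionals -/

/-- The function `a ↦ e^{-a}` on `[0, ∞]`. -/
noncomputable def expNeg (a : ℝ≥0∞) : ℝ≥0∞ := (EReal.exp a)⁻¹

/-- The inverse `q ↦ -log q` of `expNeg` on `[0, 1]`. -/
noncomputable def negLog (q : ℝ≥0∞) : ℝ≥0∞ := (ENNReal.log q⁻¹).toENNReal

@[simp]
lemma expNeg_zero : expNeg 0 = 1 := by simp [expNeg]

lemma one_le_exp_coe (a : ℝ≥0∞) : 1 ≤ EReal.exp a :=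
  EReal.one_le_exp_iff.2 (EReal.coe_ennreal_nonneg a)

lemma expNeg_le_one (a : ℝ≥0∞) : expNeg a ≤ 1 := ENNReal.inv_le_one.2 (one_le_exp_coe a)

lemma expNeg_ne_top (a : ℝ≥0∞) : expNeg a ≠ ∞ := ne_top_of_le_ne_top (by simp) (expNeg_le_one a)

lemma expNeg_add (a b : ℝ≥0∞) : expNeg (a + b) = expNeg a * expNeg b := by
  have h (c : ℝ≥0∞) : EReal.exp c ≠ 0 := (zero_lt_one.trans_le (one_le_exp_coe c)).ne'
  rw [expNeg, EReal.coe_ennreal_add, EReal.exp_add, ENNReal.mul_inv (.inl (h a)) (.inr (h b))]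
  rfl

lemma continuous_expNeg : Continuous expNeg :=
  (ENNReal.continuous_exp.comp continuous_coe_ennreal_ereal).inv

@[fun_prop]
lemma measurable_expNeg : Measurable expNeg := continuous_expNeg.measurable

lemma expNeg_sum {ι : Type*} (s : Finset ι) (f : ι → ℝ≥0∞) :
    expNeg (∑ i ∈ s, f i) = ∏ i ∈ s, expNeg (f i) := by
  classical
  induction s using Finset.induction_on with
  | empty => simp
  | insert i s hi ih => rw [Finset.sum_insert hi, Finset.prod_insert hi, expNeg_add, ih]

lemma tendsto_prod_expNeg {ι : Type*} (f : ι → ℝ≥0∞) :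
    Tendsto (fun s : Finset ι => ∏ i ∈ s, expNeg (f i)) atTop (𝓝 (expNeg (∑' i, f i))) := by
  simp_rw [← expNeg_sum]
  exact (continuous_expNeg.tendsto _).comp ENNReal.summable.hasSum

lemma negLog_expNeg (a : ℝ≥0∞) : negLog (expNeg a) = a := by
  simp [negLog, expNeg]

lemma expNeg_negLog {q : ℝ≥0∞} (hq : q ≤ 1) : expNeg (negLog q) = q := by
  rw [expNeg, negLog, EReal.coe_toENNReal, ENNReal.exp_log, inv_inv]
  rw [ENNReal.zero_le_log_iff]
  exact ENNReal.one_le_inv.2 hq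

@[fun_prop]
lemma measurable_negLog : Measurable negLog :=
  (ENNReal.measurable_log.comp measurable_inv).ereal_toENNReal

lemma expNeg_ofReal {r : ℝ} (hr : 0 ≤ r) :
    expNeg (ENNReal.ofReal r) = ENNReal.ofReal (Real.exp (-r)) := by
  rw [expNeg, EReal.coe_ennreal_ofReal, max_eq_left hr, EReal.exp_coe,
    ← ENNReal.ofReal_inv_of_pos (Real.exp_pos r), Real.exp_neg]

attribute [irreducible] expNeg negLog

namespace Configuration

/-- The random variable `ω ↦ e^{-ω(g)}`. -/
noncomputable def laplaceVar (g : I01 → ℝ≥0∞) (ω : Configuration) : ℝ≥0∞ :=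
  expNeg (∫⁻ x, g x ∂ω.toMeasure)

lemma measurable_laplaceVar {g : I01 → ℝ≥0∞} (hg : Measurable g) : Measurable (laplaceVar g) :=
  measurable_expNeg.comp (measurable_lintegral_toMeasure hg)

lemma laplaceVar_le_one (g : I01 → ℝ≥0∞) (ω : Configuration) : laplaceVar g ω ≤ 1 :=
  expNeg_le_one _

@[simp]
lemma laplaceVar_zero (ω : Configuration) : laplaceVar 0 ω = 1 := by simp [laplaceVar]

lemma laplaceVar_add {g : I01 → ℝ≥0∞} (hg : Measurable g) (h : I01 → ℝ≥0∞) (ω : Configuration) :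
    laplaceVar (g + h) ω = laplaceVar g ω * laplaceVar h ω := by
  simp [laplaceVar, lintegral_add_left hg, expNeg_add]

lemma laplaceVar_add_configuration (g : I01 → ℝ≥0∞) (ω η : Configuration) :
    laplaceVar g (ω + η) = laplaceVar g ω * laplaceVar g η := by
  simp [laplaceVar, lintegral_add_measure, expNeg_add]

/-- The vector of the variables `e^{-ω(g)}`, `g ∈ I`, as a point of a cube. -/
noncomputable def laplaceVec (I : Finset {g : I01 → ℝ≥0∞ // Measurable g}) (ω : Configuration) :
    I → unitInterval :=
  fun g => ⟨(laplaceVar g.1.1 ω).toReal, ENNReal.toReal_nonneg,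
    ENNReal.toReal_mono (by simp) (laplaceVar_le_one _ _)⟩

lemma measurable_laplaceVec (I : Finset {g : I01 → ℝ≥0∞ // Measurable g}) :
    Measurable (laplaceVec I) :=
  measurable_pi_lambda _ fun g => (measurable_laplaceVar g.1.2).ennreal_toReal.subtype_mk

/-! ### Laplace functionals determine laws and their measurability. -/

section Determining

variable {A : Type*} [MeasurableSpace A] {κ : A → Measure Configuration}
  [∀ a, IsProbabilityMeasure (κ a)]

/-- Since `e^{-η(g)} e^{-η(h)} = e^{-η(g+h)}`, every monomial in the coordinates is again a Laplace
variable, so polynomials have measurable integrals. Stone-Weierstrass on the cube extends this to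
continuous functions. -/
lemma measurable_integral_comp_laplaceVec
    (h : ∀ g : I01 → ℝ≥0∞, Measurable g → Measurable fun a => ∫⁻ η, laplaceVar g η ∂κ a)
    (I : Finset {g : I01 → ℝ≥0∞ // Measurable g}) (G : C(I → unitInterval, ℝ)) :
    Measurable fun a => ∫ η, G (laplaceVec I η) ∂κ a := by
  have hint (G : C(I → unitInterval, ℝ)) (a : A) :
      Integrable (fun η => G (laplaceVec I η)) (κ a) :=
    .of_bound (G.continuous.measurable.comp (measurable_laplaceVec I)).aestronglyMeasurable ‖G‖
      (ae_of_all _ fun η => G.norm_coe_le_norm _)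
  let coord (i : I) : C(I → unitInterval, ℝ) := ⟨fun x => x i, by fun_prop⟩
  let S := Algebra.adjoin ℝ (Set.range coord)
  have hS : ∀ G ∈ S, Measurable fun a => ∫ η, G (laplaceVec I η) ∂κ a := by
    intro G hG
    rw [← Subalgebra.mem_toSubmodule, Algebra.adjoin_eq_span] at hG
    induction hG using Submodule.span_induction with
    | mem G hG =>
      have : ∃ g, Measurable g ∧ ∀ η, G (laplaceVec I η) = (laplaceVar g η).toReal := by
        induction hG using Submonoid.closure_induction with
        | mem G hG =>
          obtain ⟨i, rfl⟩ := hG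
          exact ⟨i.1.1, i.1.2, fun η => rfl⟩
        | one => exact ⟨0, measurable_zero, fun η => by simp⟩
        | mul G H _ _ hG hH =>
          obtain ⟨g, hg, hg'⟩ := hG
          obtain ⟨k, hk, hk'⟩ := hH
          exact ⟨g + k, hg.add hk, fun η => by simp [laplaceVar_add hg, hg', hk']⟩
      obtain ⟨g, hg, hg'⟩ := this
      simp_rw [hg']
      have (a : A) : ∫ η, (laplaceVar g η).toReal ∂κ a = (∫⁻ η, laplaceVar g η ∂κ a).toReal :=
        integral_toReal (measurable_laplaceVar hg).aemeasurable
          (ae_of_all _ fun η => (expNeg_ne_top _).lt_top)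
      simp_rw [this]
      exact (h g hg).ennreal_toReal
    | zero => simp
    | add G H _ _ hG hH =>
      simp only [ContinuousMap.add_apply]
      simp_rw [integral_add (hint _ _) (hint _ _)]
      exact hG.add hH
    | smul c G _ hG =>
      simp only [ContinuousMap.smul_apply]
      simp_rw [integral_smul]
      exact hG.const_smul c
  have hsep : S.SeparatesPoints := by
    intro x y hxy
    obtain ⟨i, hi⟩ := Function.ne_iff.1 hxy
    exact ⟨coord i, ⟨coord i, Algebra.subset_adjoin ⟨i, rfl⟩, rfl⟩, fun h => hi (Subtype.ext h)⟩
  have hG : G ∈ closure (S : Set C(I → unitInterval, ℝ)) := by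
    have := ContinuousMap.subalgebra_topologicalClosure_eq_top_of_separatesPoints S hsep
    rw [← Subalgebra.topologicalClosure_coe, this]
    trivial
  obtain ⟨u, hu, hlim⟩ := mem_closure_iff_seq_limit.1 hG
  refine measurable_of_tendsto_metrizable (fun n => hS _ (hu n)) (tendsto_pi_nhds.2 fun a => ?_)
  rw [tendsto_iff_norm_sub_tendsto_zero] at hlim ⊢
  refine squeeze_zero (fun _ => norm_nonneg _) (fun n => ?_) hlim
  rw [← integral_sub (hint _ _) (hint _ _)]
  have := norm_integral_le_of_norm_le_const (μ := κ a) (C := ‖u n - G‖)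
    (ae_of_all _ fun η => (u n - G).norm_coe_le_norm (laplaceVec I η))
  simpa using this

/-- A family of probability measures on the configuration space is measurable as soon as its
Laplace functionals are. -/
lemma measurable_of_laplace
    (h : ∀ g : I01 → ℝ≥0∞, Measurable g → Measurable fun a => ∫⁻ η, laplaceVar g η ∂κ a) :
    Measurable κ := by
  let S : Set (Set Configuration) := {s | ∃ (I : Finset {g : I01 → ℝ≥0∞ // Measurable g})
    (F : Set (I → unitInterval)), IsClosed F ∧ s = laplaceVec I ⁻¹' F}
  refine .measure_of_isPiSystem (S := S) ?_ ?_ ?_ (by simp)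
  · refine le_antisymm ?_ (MeasurableSpace.generateFrom_le ?_)
    · change (inferInstance : MeasurableSpace Configuration) ≤ _
      rw [measurableSpace_eq_countingSigma, ← measurable_iff_comap_le]
      refine @Measure.measurable_of_measurable_coe _ _ _ (.generateFrom S) _ fun s hs => ?_
      -- With `g = 1_s` the Laplace variable is `e^{-ω(s)}`, and its negative logarithm returns
      -- `ω(s)`, the value `∞` included.
      let g : {g : I01 → ℝ≥0∞ // Measurable g} := ⟨s.indicator 1, measurable_one.indicator hs⟩
      have h1 : Measurable[.generateFrom S] (laplaceVec {g}) := by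
        refine @measurable_of_isClosed _ _ _ _ _ (.generateFrom S) _ fun F hF =>
          MeasurableSpace.measurableSet_generateFrom ⟨{g}, F, hF, rfl⟩
      have h2 (ω : Configuration) : ω.toMeasure s =
          negLog (ENNReal.ofReal (laplaceVec {g} ω ⟨g, by simp⟩)) := by
        simp only [laplaceVec]
        rw [laplaceVar, ENNReal.ofReal_toReal (expNeg_ne_top _), negLog_expNeg,
          lintegral_indicator_one hs]
      simp_rw [h2]
      exact measurable_negLog.comp (measurable_subtype_coe.comp
        ((measurable_pi_apply _).comp h1)).ennreal_ofReal
    · rintro _ ⟨I, F, hF, rfl⟩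
      exact measurable_laplaceVec I hF.measurableSet
  · classical
    rintro _ ⟨I, F, hF, rfl⟩ _ ⟨J, G, hG, rfl⟩ -
    refine ⟨I ∪ J, (Finset.restrict₂ (π := fun _ => unitInterval)
      Finset.subset_union_left) ⁻¹' F ∩ (Finset.restrict₂ (π := fun _ => unitInterval)
      Finset.subset_union_right) ⁻¹' G,
      (hF.preimage (Finset.continuous_restrict₂ _)).inter
        (hG.preimage (Finset.continuous_restrict₂ _)), rfl⟩
  · rintro _ ⟨I, F, hF, rfl⟩
    have hZ := measurable_laplaceVec I
    -- Indicators of closed sets are limits of bounded continuous functions, which brings in the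
    -- continuous case above.
    have hlim (a : A) : Tendsto (fun n => ∫⁻ η, hF.apprSeq n (laplaceVec I η) ∂κ a) atTop
        (𝓝 (κ a (laplaceVec I ⁻¹' F))) := by
      have := HasOuterApproxClosed.tendsto_lintegral_apprSeq hF ((κ a).map (laplaceVec I))
      rw [Measure.map_apply hZ hF.measurableSet] at this
      refine this.congr fun n => lintegral_map (f := fun x => (hF.apprSeq n x : ℝ≥0∞)) ?_ hZ
      exact (hF.apprSeq n).continuous.measurable.coe_nnreal_ennreal
    refine measurable_of_tendsto_metrizable (fun n => ?_) (tendsto_pi_nhds.2 hlim)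
    let G : C(I → unitInterval, ℝ) := ⟨fun x => hF.apprSeq n x, by fun_prop⟩
    have hG (a : A) : ∫⁻ η, hF.apprSeq n (laplaceVec I η) ∂κ a =
        ENNReal.ofReal (∫ η, G (laplaceVec I η) ∂κ a) := by
      rw [ofReal_integral_eq_lintegral_ofReal]
      · simp [G]
      · exact .of_bound (G.continuous.measurable.comp hZ).aestronglyMeasurable ‖G‖
          (ae_of_all _ fun η => G.norm_coe_le_norm _)
      · exact ae_of_all _ fun η => NNReal.coe_nonneg _
    simp_rw [hG]
    exact (measurable_integral_comp_laplaceVec h I G).ennreal_ofReal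

/-- Uniqueness is a case of measurability: index `P` and `Q` by `Bool` with the trivial σ-algebra.
The Laplace functionals are constant, so the family is measurable, and a function measurable for `⊥`
is constant. -/
lemma ext_of_laplace {P Q : Measure Configuration} [IsProbabilityMeasure P]
    [IsProbabilityMeasure Q]
    (h : ∀ g : I01 → ℝ≥0∞, Measurable g → ∫⁻ η, laplaceVar g η ∂P = ∫⁻ η, laplaceVar g η ∂Q) :
    P = Q := by
  let κ (b : Bool) : Measure Configuration := if b then P else Q
  have (b : Bool) : IsProbabilityMeasure (κ b) := by cases b <;> simp only [κ] <;> infer_instance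
  have hκ : Measurable[⊥] κ := by
    refine @measurable_of_laplace _ ⊥ κ _ fun g hg => ?_
    have hc : (fun b => ∫⁻ η, laplaceVar g η ∂κ b) = fun _ => ∫⁻ η, laplaceVar g η ∂P := by
      ext b
      cases b
      · exact (h g hg).symm
      · rfl
    rw [hc]
    exact @measurable_const _ _ _ ⊥ _
  ext B hB
  have hB' : Measurable[⊥] fun b => κ b B := (Measure.measurable_coe hB).comp hκ
  obtain ⟨c, hc⟩ := eq_const_of_measurable_bot hB'
  exact (congrFun hc true).trans (congrFun hc false).symm

end Determining

end Configuration
end BrownianGas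

namespace BrownianGas

open Filter Topology

/-! ### Configurations as countable sums of Dirac masses -/

/-- The extension by zero to `ℝ` of a function on `(0,1)`. -/
noncomputable def zeroExt (f : I01 → ℝ≥0∞) : ℝ → ℝ≥0∞ := Function.extend (↑) f 0

@[simp]
lemma zeroExt_coe (f : I01 → ℝ≥0∞) (x : I01) : zeroExt f x = f x :=
  Subtype.val_injective.extend_apply f 0 x

lemma zeroExt_of_notMem (f : I01 → ℝ≥0∞) {y : ℝ} (hy : y ∉ Set.Ioo (0 : ℝ) 1) :
    zeroExt f y = 0 := by
  rw [zeroExt, Function.extend_apply', Pi.zero_apply]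
  rintro ⟨x, rfl⟩
  exact hy x.2

lemma measurableEmbedding_coe : MeasurableEmbedding ((↑) : I01 → ℝ) :=
  .subtype_coe measurableSet_Ioo

lemma measurable_zeroExt {f : I01 → ℝ≥0∞} (hf : Measurable f) : Measurable (zeroExt f) :=
  measurableEmbedding_coe.measurable_extend hf measurable_zero

lemma lintegral_comap_coe (μ : Measure ℝ) (f : I01 → ℝ≥0∞) :
    ∫⁻ x, f x ∂μ.comap ((↑) : I01 → ℝ) = ∫⁻ x, zeroExt f x ∂μ := by
  have h1 : ∫⁻ x, f x ∂μ.comap ((↑) : I01 → ℝ) =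
      ∫⁻ x, zeroExt f x ∂(μ.comap ((↑) : I01 → ℝ)).map (↑) := by
    rw [measurableEmbedding_coe.lintegral_map]
    simp
  rw [h1, measurableEmbedding_coe.map_comap, ← lintegral_indicator
    measurableEmbedding_coe.measurableSet_range]
  refine lintegral_congr fun x => ?_
  by_cases hx : x ∈ Set.range ((↑) : I01 → ℝ)
  · rw [Set.indicator_of_mem hx]
  · rw [Set.indicator_of_notMem hx, zeroExt_of_notMem]
    simpa using hx

lemma lintegral_comap_sum_dirac {ι : Type*} (y : ι → ℝ) {f : I01 → ℝ≥0∞} (hf : Measurable f) :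
    ∫⁻ x, f x ∂(Measure.sum fun i => Measure.dirac (y i)).comap ((↑) : I01 → ℝ) =
      ∑' i, zeroExt f (y i) := by
  rw [lintegral_comap_coe, lintegral_sum_measure]
  exact tsum_congr fun i => lintegral_dirac' _ (measurable_zeroExt hf)

/-- The total weight `∑ᵢ m(yᵢ)` of the points of the family `y` in `(0,1)`. -/
noncomputable def totalWeight {ι : Type*} (y : ι → ℝ) : ℝ≥0∞ :=
  ∑' i, zeroExt (fun x => ENNReal.ofReal (m x)) (y i)

/-- Sums of Dirac masses are integer-valued, and temperedness forces the Radon property because `m`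
has a positive minimum on each nonempty compact set. Only the total weight has to be controlled. -/
lemma isConfiguration_sum_dirac_iff {ι : Type*} (y : ι → ℝ) :
    IsConfiguration ((Measure.sum fun i => Measure.dirac (y i)).comap ((↑) : I01 → ℝ)) ↔
      totalWeight y < ∞ := by
  have hw : ∫⁻ x, ENNReal.ofReal (m x) ∂(Measure.sum fun i => Measure.dirac (y i)).comap
      ((↑) : I01 → ℝ) = totalWeight y :=
    lintegral_comap_sum_dirac y continuous_ofReal_m.measurable
  refine ⟨fun h => hw ▸ h.tempered, fun h => ⟨fun K hK => ?_, fun A hA => ?_, hw ▸ h⟩⟩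
  · rcases K.eq_empty_or_nonempty with rfl | hne
    · simp
    obtain ⟨x, -, hx⟩ := hK.exists_isMinOn hne continuous_m.continuousOn
    have hpos : ENNReal.ofReal (m x) ≠ 0 := by simpa using m_pos x
    set ν := (Measure.sum fun i => Measure.dirac (y i)).comap ((↑) : I01 → ℝ)
    have hle : ENNReal.ofReal (m x) * ν K < ∞ := by
      refine lt_of_le_of_lt ?_ (hw ▸ h)
      calc ENNReal.ofReal (m x) * ν K = ∫⁻ _ in K, ENNReal.ofReal (m x) ∂ν := by simp
        _ ≤ ∫⁻ z in K, ENNReal.ofReal (m z) ∂ν :=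
          setLIntegral_mono continuous_ofReal_m.measurable
            fun z hz => ENNReal.ofReal_le_ofReal (hx hz)
        _ ≤ ∫⁻ z, ENNReal.ofReal (m z) ∂ν := setLIntegral_le_lintegral _ _
    by_contra! htop
    rw [top_le_iff.1 htop, ENNReal.mul_top hpos] at hle
    exact lt_irrefl _ hle
  · refine ⟨{i | y i ∈ ((↑) : I01 → ℝ) '' A}.encard, ?_⟩
    rw [← lintegral_indicator_one hA, lintegral_comap_sum_dirac y (measurable_one.indicator hA),
      ← ENNReal.tsum_set_one, tsum_subtype {i | y i ∈ ((↑) : I01 → ℝ) '' A} fun _ => (1 : ℝ≥0∞)]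
    refine tsum_congr fun i => ?_
    by_cases hi : y i ∈ Set.Ioo (0 : ℝ) 1
    · have : zeroExt (A.indicator 1) (y i) = A.indicator 1 (⟨y i, hi⟩ : I01) := zeroExt_coe _ ⟨_, hi⟩
      rw [this]
      by_cases hA' : (⟨y i, hi⟩ : I01) ∈ A
      · rw [Set.indicator_of_mem hA', Set.indicator_of_mem]
        · rfl
        · exact ⟨_, hA', rfl⟩
      · rw [Set.indicator_of_notMem hA', Set.indicator_of_notMem]
        rintro ⟨z, hz, hzi⟩
        exact hA' ((Subtype.ext hzi : z = ⟨y i, hi⟩) ▸ hz)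
    · rw [zeroExt_of_notMem _ hi, Set.indicator_of_notMem]
      rintro ⟨z, -, hz⟩
      exact hi (hz ▸ z.2)

namespace Configuration

lemma toMeasure_ofPoints {ι : Type*} {y : ι → ℝ} (h : totalWeight y < ∞) :
    (ofPoints y).toMeasure =
      (Measure.sum fun i => Measure.dirac (y i)).comap ((↑) : I01 → ℝ) := by
  rw [ofPoints, dif_pos ((isConfiguration_sum_dirac_iff y).2 h)]

lemma ofPoints_eq_zero {ι : Type*} {y : ι → ℝ} (h : ¬ totalWeight y < ∞) : ofPoints y = 0 := by
  rw [ofPoints, dif_neg ((isConfiguration_sum_dirac_iff y).not.2 h)]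

lemma lintegral_ofPoints {ι : Type*} {y : ι → ℝ} (h : totalWeight y < ∞) {f : I01 → ℝ≥0∞}
    (hf : Measurable f) : ∫⁻ x, f x ∂(ofPoints y).toMeasure = ∑' i, zeroExt f (y i) := by
  rw [toMeasure_ofPoints h, lintegral_comap_sum_dirac y hf]

lemma laplaceVar_ofPoints {ι : Type*} {y : ι → ℝ} (h : totalWeight y < ∞) {g : I01 → ℝ≥0∞}
    (hg : Measurable g) : laplaceVar g (ofPoints y) = expNeg (∑' i, zeroExt g (y i)) := by
  rw [laplaceVar, lintegral_ofPoints h hg]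

lemma measurable_ofPoints {X ι : Type*} [MeasurableSpace X] [Countable ι] {y : X → ι → ℝ}
    (hy : ∀ i, Measurable fun x => y x i) : Measurable fun x => ofPoints (y x) := by
  have hsum {f : I01 → ℝ≥0∞} (hf : Measurable f) :
      Measurable fun x => ∑' i, zeroExt f (y x i) :=
    .tsum fun i => (measurable_zeroExt hf).comp (hy i)
  have hS : MeasurableSet {x | totalWeight (y x) < ∞} :=
    (hsum continuous_ofReal_m.measurable) measurableSet_Iio
  refine measurable_iff_toMeasure.2 (Measure.measurable_of_measurable_coe _ fun A hA => ?_)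
  have h : (fun x => (ofPoints (y x)).toMeasure A) = {x | totalWeight (y x) < ∞}.indicator
      fun x => ∑' i, zeroExt (A.indicator 1) (y x i) := by
    ext x
    by_cases hx : totalWeight (y x) < ∞
    · rw [Set.indicator_of_mem (s := {x | totalWeight (y x) < ∞}) hx,
        ← lintegral_indicator_one hA, lintegral_ofPoints hx (measurable_one.indicator hA)]
    · rw [Set.indicator_of_notMem (s := {x | totalWeight (y x) < ∞}) hx, ofPoints_eq_zero hx]
      simp
  rw [h]
  exact (hsum (measurable_one.indicator hA)).indicator hS

section Particles

variable (ω : Configuration)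

instance : IsFiniteMeasureOnCompacts ω.toMeasure := ⟨fun K hK => ω.isConfiguration.radon K hK⟩

instance : LocallyCompactSpace I01 := isOpen_Ioo.locallyCompactSpace

instance : IsLocallyFiniteMeasure ω.toMeasure :=
  isLocallyFiniteMeasure_of_isFiniteMeasureOnCompacts

lemma countable_atoms : {x : I01 | 0 < ω.toMeasure {x}}.Countable :=
  Measure.countable_meas_pos_of_disjoint_iUnion (fun _ => measurableSet_singleton _)
    fun _ _ h => Set.disjoint_singleton.2 h

/-- By outer regularity a point that is not an atom has a neighbourhood of measure less than `1`,
hence `0` by integrality; a locally null set is null. -/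
lemma measure_compl_atoms : ω.toMeasure {x : I01 | 0 < ω.toMeasure {x}}ᶜ = 0 := by
  refine measure_null_of_locally_null _ fun x hx => ?_
  have hx0 : ω.toMeasure {x} < 1 := by
    have : ω.toMeasure {x} = 0 := by simpa using hx
    simp [this]
  obtain ⟨U, hxU, hU, hU1⟩ := Set.exists_isOpen_lt_of_lt _ _ hx0
  refine ⟨U, mem_nhdsWithin_of_mem_nhds (hU.mem_nhds (hxU rfl)), ?_⟩
  obtain ⟨n, hn⟩ := ω.isConfiguration.integer_valued U hU.measurableSet
  rw [hn] at hU1 ⊢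
  have : n < 1 := by exact_mod_cast hU1
  rw [Order.lt_one_iff.1 this]
  simp

/-- The mass of a point is a finite integer, so the floor and `toReal` in `Particle` lose nothing.
-/
lemma measure_singleton (x : I01) :
    ω.toMeasure {x} = (⌊(ω.toMeasure {x}).toReal⌋₊ : ℝ≥0∞) := by
  obtain ⟨n, hn⟩ := ω.isConfiguration.integer_valued {x} (measurableSet_singleton x)
  have hfin := ω.isConfiguration.radon {x} isCompact_singleton
  rw [hn] at hfin ⊢
  have hn' : n ≠ ⊤ := by rintro rfl; simp at hfin
  lift n to ℕ using hn'
  simp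

instance : Countable ω.Particle := by
  have := ω.countable_atoms.to_subtype
  have hpos (p : ω.Particle) : p.1 ∈ {x : I01 | 0 < ω.toMeasure {x}} := by
    have : 0 < ⌊(ω.toMeasure {p.1}).toReal⌋₊ := p.2.pos
    rw [Set.mem_ofPred_eq, measure_singleton]
    exact_mod_cast this
  let F (p : ω.Particle) : {x : I01 | 0 < ω.toMeasure {x}} × ℕ := (⟨p.1, hpos p⟩, p.2)
  refine Function.Injective.countable (f := F) ?_
  rintro ⟨x, i⟩ ⟨y, j⟩ h
  simp only [F, Prod.mk.injEq, Subtype.mk.injEq] at h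
  obtain ⟨rfl, h⟩ := h
  exact congrArg (Sigma.mk x) (Fin.ext h)

lemma lintegral_eq_tsum_particle (f : I01 → ℝ≥0∞) :
    ∫⁻ x, f x ∂ω.toMeasure = ∑' p : ω.Particle, f p.1 := by
  have h1 : ∫⁻ x, f x ∂ω.toMeasure = ∫⁻ x in {x : I01 | 0 < ω.toMeasure {x}}, f x ∂ω.toMeasure := by
    rw [Measure.restrict_eq_self_of_ae_mem]
    exact ω.measure_compl_atoms
  rw [h1, lintegral_countable f ω.countable_atoms, tsum_subtype {x : I01 | 0 < ω.toMeasure {x}}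
    fun x => f x * ω.toMeasure {x}]
  refine Eq.trans (tsum_congr fun x => ?_) (ENNReal.tsum_sigma' fun p : ω.Particle => f p.1).symm
  have h2 : ∑' _ : Fin ⌊(ω.toMeasure {x}).toReal⌋₊, f x = f x * ω.toMeasure {x} := by
    rw [tsum_fintype, Finset.sum_const, Finset.card_univ, Fintype.card_fin, nsmul_eq_mul, mul_comm,
      ← measure_singleton]
  refine Eq.trans ?_ h2.symm
  by_cases hx : 0 < ω.toMeasure {x}
  · exact Set.indicator_of_mem (s := {x : I01 | 0 < ω.toMeasure {x}}) hx _
  · rw [Set.indicator_of_notMem (s := {x : I01 | 0 < ω.toMeasure {x}}) hx]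
    simp [nonpos_iff_eq_zero.1 (not_lt.1 hx)]

end Particles

end Configuration
end BrownianGas

namespace BrownianGas

open Filter Topology

/-! ### Absorbed paths -/

/-- For a continuous path and a closed set the infimum is attained. -/
lemma hittingAfter_le_iff {S : Type*} {u : ℝ≥0 → S → ℝ} {F : Set ℝ} (hF : IsClosed F) {s : S}
    (hu : Continuous fun t => u t s) (c : ℝ≥0) :
    hittingAfter u F 0 s ≤ (c : WithTop ℝ≥0) ↔ ∃ v ≤ c, u v s ∈ F := by
  refine ⟨fun h => ?_, fun ⟨v, hv, hvF⟩ =>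
    (hittingAfter_le_of_mem zero_le hvF).trans (by exact_mod_cast hv)⟩
  have hex : ∃ j, 0 ≤ j ∧ u j s ∈ F := by
    by_contra! hne
    rw [hittingAfter_eq_top_iff.2 hne] at h
    exact absurd (top_le_iff.1 h) WithTop.coe_ne_top
  have hcl : IsClosed {i : ℝ≥0 | 0 ≤ i ∧ u i s ∈ F} :=
    (isClosed_le continuous_const continuous_id).inter (hF.preimage hu)
  have hmem := hcl.csInf_mem hex (OrderBot.bddBelow _)
  rw [hittingAfter, if_pos hex] at h
  exact ⟨_, by exact_mod_cast h, hmem.2⟩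

section Path

variable {S : Type*} {W : ℝ≥0 → S → ℝ} {x : ℝ} {s : S}

/-- The time `t ∧ τ`, with `τ` the exit time from `(0,1)` of the path `x + W`. -/
noncomputable def exitMin (W : ℝ≥0 → S → ℝ) (x : ℝ) (t : ℝ≥0) (s : S) : ℝ≥0 :=
  (min (t : WithTop ℝ≥0) (hittingAfter (fun t s => x + W t s) (Set.Ioo (0 : ℝ) 1)ᶜ 0 s)).untopA

lemma absorbed_eq (W : ℝ≥0 → S → ℝ) (x : ℝ) (t : ℝ≥0) (s : S) :
    absorbed W x t s = x + W (exitMin W x t s) s := rfl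

/-- Later identities between exit times are proved by comparing upper bounds through this criterion.
-/
lemma exitMin_le_iff (hW : Continuous fun t => W t s) (t c : ℝ≥0) :
    exitMin W x t s ≤ c ↔ t ≤ c ∨ ∃ u ≤ c, x + W u s ∉ Set.Ioo (0 : ℝ) 1 := by
  have hne : min (t : WithTop ℝ≥0)
      (hittingAfter (fun t s => x + W t s) (Set.Ioo (0 : ℝ) 1)ᶜ 0 s) ≠ ⊤ :=
    ne_top_of_le_ne_top WithTop.coe_ne_top (min_le_left _ _)
  have h : (exitMin W x t s : WithTop ℝ≥0) = min (t : WithTop ℝ≥0)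
      (hittingAfter (fun t s => x + W t s) (Set.Ioo (0 : ℝ) 1)ᶜ 0 s) := by
    rw [exitMin, WithTop.untopA_eq_untop hne, WithTop.coe_untop]
  rw [← WithTop.coe_le_coe, h, min_le_iff, WithTop.coe_le_coe,
    hittingAfter_le_iff isOpen_Ioo.isClosed_compl (by fun_prop)]
  rfl

lemma exitMin_of_survive (hW : Continuous fun t => W t s) {t : ℝ≥0}
    (h : ∀ u ≤ t, x + W u s ∈ Set.Ioo (0 : ℝ) 1) : exitMin W x t s = t := by
  refine le_antisymm ((exitMin_le_iff hW _ _).2 (.inl le_rfl)) ?_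
  by_contra! hlt
  rcases (exitMin_le_iff hW _ _).1 le_rfl with h' | ⟨u, hu, hu'⟩
  · exact absurd h' (not_le.2 hlt)
  · exact hu' (h u (hu.trans hlt.le))

lemma absorbed_of_survive (hW : Continuous fun t => W t s) {t : ℝ≥0}
    (h : ∀ u ≤ t, x + W u s ∈ Set.Ioo (0 : ℝ) 1) : absorbed W x t s = x + W t s := by
  rw [absorbed_eq, exitMin_of_survive hW h]

lemma exitMin_le (hW : Continuous fun t => W t s) (t : ℝ≥0) : exitMin W x t s ≤ t :=
  (exitMin_le_iff hW _ _).2 (.inl le_rfl)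

lemma absorbed_notMem_of_exit (hW : Continuous fun t => W t s) {t : ℝ≥0}
    (h : ∃ u ≤ t, x + W u s ∉ Set.Ioo (0 : ℝ) 1) : absorbed W x t s ∉ Set.Ioo (0 : ℝ) 1 := by
  have hex : ∃ u ≤ exitMin W x t s, x + W u s ∉ Set.Ioo (0 : ℝ) 1 := by
    rcases (exitMin_le_iff hW t _).1 le_rfl with h' | h'
    · exact h.imp fun u hu => ⟨hu.1.trans h', hu.2⟩
    · exact h'
  obtain ⟨u, hu, hu'⟩ := hex
  rcases hu.eq_or_lt with rfl | hlt
  · exact hu'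
  · exact absurd ((exitMin_le_iff hW t u).2 (.inr ⟨u, le_rfl, hu'⟩)) (not_le.2 hlt)

lemma absorbed_mem_Ioo_iff (hW : Continuous fun t => W t s) {t : ℝ≥0} :
    absorbed W x t s ∈ Set.Ioo (0 : ℝ) 1 ↔ ∀ u ≤ t, x + W u s ∈ Set.Ioo (0 : ℝ) 1 := by
  refine ⟨fun h => ?_, fun h => ?_⟩
  · by_contra! hne
    exact absorbed_notMem_of_exit hW hne h
  · rw [absorbed_of_survive hW h]
    exact h t le_rfl

/-- Before the stopping time the path is in `(0,1)`, so by continuity its stopped position lies in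
the closure; if the stopping time is `0`, that position is `x`. -/
lemma absorbed_mem_Icc (hW : Continuous fun t => W t s) (h0 : W 0 s = 0)
    (hx : x ∈ Set.Icc (0 : ℝ) 1) (t : ℝ≥0) : absorbed W x t s ∈ Set.Icc (0 : ℝ) 1 := by
  rw [absorbed_eq]
  set r := exitMin W x t s with hr
  rcases eq_zero_or_pos r with h | h
  · rwa [h, h0, add_zero]
  · have hmaps : Set.MapsTo (fun u => x + W u s) (Set.Iio r) (Set.Ioo (0 : ℝ) 1) := by
      intro u hu
      by_contra hu'
      exact absurd ((exitMin_le_iff hW t u).2 (.inr ⟨u, le_rfl, hu'⟩)) (not_le.2 hu)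
    have hmem : r ∈ closure (Set.Iio r) := by
      rw [closure_Iio' (a := r) (⟨0, h⟩ : (Set.Iio r).Nonempty)]
      exact Set.mem_Iic.2 le_rfl
    have := map_mem_closure (f := fun u => x + W u s) (by fun_prop) hmem hmaps
    rwa [closure_Ioo zero_ne_one] at this

lemma absorbed_eq_of_notMem (hW : Continuous fun t => W t s) {v t : ℝ≥0} (hvt : v ≤ t)
    (h : absorbed W x v s ∉ Set.Ioo (0 : ℝ) 1) : absorbed W x t s = absorbed W x v s := by
  rw [absorbed_mem_Ioo_iff hW] at h
  push Not at h
  obtain ⟨u₀, hu₀, hu₀'⟩ := h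
  have : exitMin W x t s = exitMin W x v s := by
    refine eq_of_forall_ge_iff fun c => ?_
    rw [exitMin_le_iff hW, exitMin_le_iff hW]
    constructor
    · rintro (h | h)
      · exact .inl (hvt.trans h)
      · exact .inr h
    · rintro (h | h)
      · exact .inr ⟨u₀, hu₀.trans h, hu₀'⟩
      · exact .inr h
  rw [absorbed_eq, absorbed_eq, this]

lemma absorbed_zero (hW : Continuous fun t => W t s) (x : ℝ) :
    absorbed W x 0 s = x + W 0 s := by
  rw [absorbed_eq, nonpos_iff_eq_zero.1 (exitMin_le hW 0)]

/-- The flow property of the absorbed path. -/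
lemma absorbed_add (hW : Continuous fun t => W t s) (t r : ℝ≥0) :
    absorbed W x (t + r) s =
      absorbed (fun v s => W (t + v) s - W t s) (absorbed W x t s) r s := by
  have hW' : Continuous fun v => W (t + v) s - W t s := by fun_prop
  by_cases h : absorbed W x t s ∈ Set.Ioo (0 : ℝ) 1
  · have hs := (absorbed_mem_Ioo_iff hW).1 h
    rw [absorbed_of_survive hW hs, absorbed_eq W, absorbed_eq]
    have : exitMin W x (t + r) s =
        t + exitMin (fun v s => W (t + v) s - W t s) (x + W t s) r s := by
      refine eq_of_forall_ge_iff fun c => ?_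
      rw [exitMin_le_iff hW]
      rcases lt_or_ge c t with hc | hc
      · refine iff_of_false ?_ fun h => absurd (le_self_add.trans h) (not_le.2 hc)
        rintro (h | ⟨u, hu, hu'⟩)
        · exact absurd (le_self_add.trans h) (not_le.2 hc)
        · exact hu' (hs u (hu.trans hc.le))
      · obtain ⟨d, rfl⟩ := exists_add_of_le hc
        rw [add_le_add_iff_left, add_le_add_iff_left,
          exitMin_le_iff (W := fun v s => W (t + v) s - W t s) hW']
        refine or_congr_right ⟨?_, ?_⟩
        · rintro ⟨u, hu, hu'⟩
          rcases lt_or_ge u t with hut | hut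
          · exact absurd (hs u hut.le) hu'
          · obtain ⟨v, rfl⟩ := exists_add_of_le hut
            exact ⟨v, (add_le_add_iff_left t).1 hu, by simpa using hu'⟩
        · rintro ⟨v, hv, hv'⟩
          exact ⟨t + v, by gcongr, by simpa using hv'⟩
    rw [this]
    ring
  -- The path is already absorbed, and the restarted one, being outside `(0,1)` at time `0`, never
  -- moves.
  · rw [absorbed_eq_of_notMem hW le_self_add h]
    have := absorbed_eq_of_notMem (W := fun v s => W (t + v) s - W t s) (x := absorbed W x t s)
      (s := s) hW' (zero_le (a := r))
    rw [absorbed_zero (W := fun v s => W (t + v) s - W t s) hW'] at this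
    simp only [add_zero, sub_self] at this
    exact (this h).symm

/-- The absorbed path up to time `t` depends only on the driving path up to time `t`. -/
lemma absorbed_congr {W' : ℝ≥0 → S → ℝ} (hW : Continuous fun t => W t s)
    (hW' : Continuous fun t => W' t s) {t : ℝ≥0} (h : ∀ u ≤ t, W u s = W' u s) :
    absorbed W x t s = absorbed W' x t s := by
  have : exitMin W x t s = exitMin W' x t s := by
    refine eq_of_forall_ge_iff fun c => ?_
    rw [exitMin_le_iff hW, exitMin_le_iff hW']
    rcases le_or_gt t c with hc | hc
    · exact iff_of_true (.inl hc) (.inl hc)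
    · refine or_congr_right (exists_congr fun u => and_congr_right fun hu => ?_)
      rw [h u (hu.trans hc.le)]
  rw [absorbed_eq, absorbed_eq, this, h _ (exitMin_le hW' t)]

/-- The stopped clock is `t ↦ min t σ` for a constant `σ` if the path exits, and the identity
otherwise. -/
lemma continuous_absorbed (hW : Continuous fun t => W t s) :
    Continuous fun t => absorbed W x t s := by
  have hcomp : Continuous fun t => exitMin W x t s := by
    by_cases hex : ∃ u, x + W u s ∉ Set.Ioo (0 : ℝ) 1
    · obtain ⟨u, hu⟩ := hex
      have (t : ℝ≥0) : exitMin W x t s = min t (exitMin W x u s) := by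
        refine eq_of_forall_ge_iff fun c => ?_
        rw [min_le_iff, exitMin_le_iff hW, exitMin_le_iff hW]
        refine or_congr_right ⟨.inr, ?_⟩
        rintro (h | h)
        · exact ⟨u, h, hu⟩
        · exact h
      rw [funext this]
      fun_prop
    · push Not at hex
      have (t : ℝ≥0) : exitMin W x t s = t := exitMin_of_survive hW fun u _ => hex u
      rw [funext this]
      fun_prop
  exact continuous_const.add (hW.comp hcomp)

/-- A point outside `(0,1)` is a trap, so having hit it by time `t` is the same as being there at
time `t`. -/
lemma hitTime_le_iff (hW : Continuous fun t => W t s) {a : ℝ} (ha : a ∉ Set.Ioo (0 : ℝ) 1)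
    (t : ℝ≥0) : hitTime W x a s ≤ (t : WithTop ℝ≥0) ↔ absorbed W x t s = a := by
  rw [hitTime, hittingAfter_le_iff isClosed_singleton (continuous_absorbed hW)]
  refine ⟨fun ⟨v, hv, hva⟩ => ?_, fun h => ⟨t, le_rfl, h⟩⟩
  rw [Set.mem_singleton_iff] at hva
  rw [absorbed_eq_of_notMem hW hv (hva ▸ ha), hva]

/-- On the compact interval `[0,c]` a surviving path keeps a distance at least `1/(n+1)` from the
boundary. This is a closed condition, so a dense sequence of times suffices, which gives survival a
countable description. -/
lemma survive_iff {S : Type*} {Z : ℝ≥0 → S → ℝ} {s : S} (hZ : Continuous fun t => Z t s) (c : ℝ≥0) :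
    (∀ u ≤ c, Z u s ∈ Set.Ioo (0 : ℝ) 1) ↔ ∃ n : ℕ, ∀ k : ℕ,
      Z (TopologicalSpace.denseSeq (Set.Iic c) k) s ∈
        Set.Icc (1 / (n + 1 : ℝ)) (1 - 1 / (n + 1)) := by
  constructor
  · intro h
    have hK : IsCompact (Set.Iic c) := by
      rw [← Set.Icc_bot]; exact isCompact_Icc
    obtain ⟨u, hu, hmin⟩ := hK.exists_isMinOn ⟨c, Set.mem_Iic.2 le_rfl⟩
      (f := fun u => min (Z u s) (1 - Z u s)) (by fun_prop)
    have hpos : 0 < min (Z u s) (1 - Z u s) := lt_min (h u hu).1 (sub_pos.2 (h u hu).2)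
    obtain ⟨n, hn⟩ := exists_nat_one_div_lt hpos
    refine ⟨n, fun k => ?_⟩
    have := hmin (TopologicalSpace.denseSeq (Set.Iic c) k).2
    have := hn.le.trans this
    exact ⟨this.trans (min_le_left _ _), by linarith [this.trans (min_le_right _ _)]⟩
  · rintro ⟨n, hn⟩ u hu
    have hcl : IsClosed {v : Set.Iic c | Z v s ∈ Set.Icc (1 / (n + 1 : ℝ)) (1 - 1 / (n + 1))} :=
      isClosed_Icc.preimage (hZ.comp continuous_subtype_val)
    have hd := (TopologicalSpace.denseRange_denseSeq (Set.Iic c)).closure_range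
    have hsub := hcl.closure_subset_iff.2 (Set.range_subset_iff.2 hn)
    rw [hd] at hsub
    have := hsub (Set.mem_univ (⟨u, hu⟩ : Set.Iic c))
    have hp : (0 : ℝ) < 1 / (n + 1) := by positivity
    exact ⟨hp.trans_le this.1, this.2.trans_lt (by linarith)⟩

/-- Joint measurability of the absorbed path in the time, the starting point and the driving
path. -/
lemma measurable_absorbed [MeasurableSpace S] (hW : ∀ s, Continuous fun t => W t s)
    (hm : ∀ t, Measurable (W t)) :
    Measurable fun p : ℝ≥0 × ℝ × S => absorbed W p.2.1 p.1 p.2.2 := by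
  have hσ : Measurable fun p : ℝ≥0 × ℝ × S => exitMin W p.2.1 p.1 p.2.2 := by
    refine measurable_of_Iic fun c => ?_
    have : (fun p : ℝ≥0 × ℝ × S => exitMin W p.2.1 p.1 p.2.2) ⁻¹' Set.Iic c =
        {p | p.1 ≤ c} ∪ {p | ∃ n : ℕ, ∀ k : ℕ,
          p.2.1 + W (TopologicalSpace.denseSeq (Set.Iic c) k) p.2.2 ∈
          Set.Icc (1 / (n + 1 : ℝ)) (1 - 1 / (n + 1))}ᶜ := by
      ext p
      rw [Set.mem_preimage, Set.mem_Iic, exitMin_le_iff (hW _), Set.mem_union, Set.mem_compl_iff,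
        Set.mem_ofPred_eq, Set.mem_ofPred_eq,
        ← survive_iff (Z := fun u (p : ℝ≥0 × ℝ × S) => p.2.1 + W u p.2.2)
          (by have := hW p.2.2; fun_prop)]
      push Not
      rfl
    rw [this]
    refine (measurable_fst measurableSet_Iic).union (MeasurableSet.compl ?_)
    simp only [Set.ofPred_exists, Set.ofPred_forall]
    refine .iUnion fun n => .iInter fun k => ?_
    exact (measurable_snd.fst.add ((hm _).comp measurable_snd.snd)) measurableSet_Icc
  have hU := measurable_uncurry_of_continuous_of_measurable hW hm
  exact measurable_snd.fst.add (hU.comp (hσ.prodMk measurable_snd.snd))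

end Path

end BrownianGas

namespace BrownianGas

open Filter Topology

/-! ### Brownian motions with continuous paths -/

/-- A measurable Brownian motion started at `0` all of whose paths are continuous. -/
structure IsRegularBrownian {S : Type*} [MeasurableSpace S] (W : ℝ≥0 → S → ℝ) (Pr : Measure S) :
    Prop where
  isPreBrownian : IsPreBrownianReal W Pr
  continuous_path : ∀ s, Continuous fun t => W t s
  measurable : ∀ t, Measurable (W t)
  zero : ∀ s, W 0 s = 0

variable {S : Type*} [MeasurableSpace S] {Pr : Measure S} {W : ℝ≥0 → S → ℝ}

/-- A Brownian motion is indistinguishable from a regular one. -/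
lemma exists_isRegularBrownian (hW : IsBrownianReal W Pr) :
    ∃ W' : ℝ≥0 → S → ℝ, IsRegularBrownian W' Pr ∧ ∀ᵐ s ∂Pr, ∀ t, W t s = W' t s := by
  let d := TopologicalSpace.denseSeq ℝ≥0
  have hgood : ∀ᵐ s ∂Pr, Continuous (W · s) ∧ W 0 s = 0 ∧
      ∀ k, W (d k) s = (hW.aemeasurable (d k)).mk _ s := by
    filter_upwards [hW.cont, hW.eval_zero_ae_eq_zero,
      ae_all_iff.2 fun k => (hW.aemeasurable (d k)).ae_eq_mk] with s h1 h2 h3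
    exact ⟨h1, h2, h3⟩
  -- The regular process is `W` on the measurable set `A` of full measure and `0` elsewhere.
  obtain ⟨A, hAe, hA, hAg⟩ := hgood.exists_measurable_mem
  have hcont (s : S) : Continuous fun t => A.indicator (W t) s := by
    by_cases hs : s ∈ A
    · simpa only [Set.indicator_of_mem hs] using (hAg s hs).1
    · simpa only [Set.indicator_of_notMem hs] using continuous_const
  have hae : ∀ᵐ s ∂Pr, ∀ t, W t s = A.indicator (W t) s := by
    filter_upwards [hAe] with s hs t
    rw [Set.indicator_of_mem hs]
  refine ⟨fun t => A.indicator (W t), ⟨hW.toIsPreBrownianReal.congr fun t => ?_, hcont,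
    fun t => ?_, fun s => ?_⟩, hae⟩
  · filter_upwards [hae] with s hs using hs t
  -- Each `W t` is only a.e. measurable, but at the countably many times `d k` it agrees on `A` with
  -- a measurable version; the other times are limits.
  · obtain ⟨u, hu, hlim⟩ := mem_closure_iff_seq_limit.1
      ((TopologicalSpace.denseRange_denseSeq ℝ≥0).closure_range ▸ Set.mem_univ t)
    refine measurable_of_tendsto_metrizable (f := fun n => A.indicator (W (u n))) (fun n => ?_)
      (tendsto_pi_nhds.2 fun s => ((hcont s).tendsto t).comp hlim)
    obtain ⟨k, hk⟩ := hu n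
    have : A.indicator (W (u n)) = A.indicator ((hW.aemeasurable (d k)).mk _) := by
      rw [← hk]
      exact Set.indicator_congr fun s hs => (hAg s hs).2.2 k
    rw [this]
    exact (hW.aemeasurable (d k)).measurable_mk.indicator hA
  · by_cases hs : s ∈ A
    · rw [Set.indicator_of_mem hs, (hAg s hs).2.1]
    · rw [Set.indicator_of_notMem hs]

namespace IsRegularBrownian

/-- The space of continuous paths, with the σ-algebra generated by the coordinates. -/
abbrev PathSpace : Type := {w : ℝ≥0 → ℝ // Continuous w}

/-- The coordinate process on the path space. -/
def coord (t : ℝ≥0) (w : PathSpace) : ℝ := w.1 t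

lemma measurable_absorbed_coord :
    Measurable fun p : ℝ≥0 × ℝ × PathSpace => absorbed coord p.2.1 p.1 p.2.2 :=
  measurable_absorbed (fun w => w.2) fun t => (measurable_pi_apply t).comp measurable_subtype_coe

/-- The path map of a continuous process. -/
def pathMap (W : ℝ≥0 → S → ℝ) (hc : ∀ s, Continuous fun t => W t s) (s : S) : PathSpace :=
  ⟨fun t => W t s, hc s⟩

lemma measurable_pathMap (hc : ∀ s, Continuous fun t => W t s) (hm : ∀ t, Measurable (W t)) :
    Measurable (pathMap W hc) :=
  (measurable_pi_lambda _ hm).subtype_mk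

lemma isProbabilityMeasure (hW : IsRegularBrownian W Pr) : IsProbabilityMeasure Pr :=
  hW.isPreBrownian.isGaussianProcess.isProbabilityMeasure

/-- The finite-dimensional laws coincide and determine the law on the product, whose trace is the
σ-algebra of the path space. -/
lemma map_pathMap_eq {V : ℝ≥0 → S → ℝ} (hV : IsRegularBrownian V Pr)
    (hW : IsRegularBrownian W Pr) :
    Pr.map (pathMap V hV.continuous_path) = Pr.map (pathMap W hW.continuous_path) := by
  have := hW.isProbabilityMeasure
  have hVm := measurable_pi_lambda (fun s t => V t s) hV.measurable
  have hWm := measurable_pi_lambda (fun s t => W t s) hW.measurable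
  have key : Pr.map (fun s t => V t s) = Pr.map (fun s t => W t s) := by
    rw [map_eq_iff_forall_finset_map_restrict_eq hVm.aemeasurable hWm.aemeasurable]
    exact fun I => (hV.isPreBrownian.hasLaw I).map_eq.trans (hW.isPreBrownian.hasLaw I).map_eq.symm
  ext B hB
  obtain ⟨B', hB', rfl⟩ := hB
  rw [Measure.map_apply (measurable_pathMap _ hV.measurable) (measurable_subtype_coe hB'),
    Measure.map_apply (measurable_pathMap _ hW.measurable) (measurable_subtype_coe hB')]
  have := congrArg (· B') key
  simp only [Measure.map_apply hVm hB', Measure.map_apply hWm hB'] at this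
  exact this

/-- The law of the absorbed path does not depend on the choice of the Brownian motion. -/
lemma lintegral_absorbed_eq {V : ℝ≥0 → S → ℝ} (hV : IsRegularBrownian V Pr)
    (hW : IsRegularBrownian W Pr) {F : ℝ → ℝ≥0∞} (hF : Measurable F) (x : ℝ) (t : ℝ≥0) :
    ∫⁻ s, F (absorbed V x t s) ∂Pr = ∫⁻ s, F (absorbed W x t s) ∂Pr := by
  have hm : Measurable fun w : PathSpace => F (absorbed coord x t w) :=
    hF.comp (measurable_absorbed_coord.comp (measurable_const.prodMk
      (measurable_const.prodMk measurable_id)))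
  have h {V : ℝ≥0 → S → ℝ} (hV : IsRegularBrownian V Pr) : ∫⁻ s, F (absorbed V x t s) ∂Pr =
      ∫⁻ w, F (absorbed coord x t w) ∂Pr.map (pathMap V hV.continuous_path) :=
    (lintegral_map hm (measurable_pathMap _ hV.measurable)).symm
  rw [h hV, h hW, map_pathMap_eq hV hW]

/-- The increments of a regular Brownian motion after time `t`. -/
lemma shift (hW : IsRegularBrownian W Pr) (t : ℝ≥0) :
    IsRegularBrownian (fun v s => W (t + v) s - W t s) Pr where
  isPreBrownian := hW.isPreBrownian.shift t
  continuous_path s := by have := hW.continuous_path s; fun_prop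
  measurable v := (hW.measurable _).sub (hW.measurable _)
  zero s := by simp

/-- The σ-algebra generated by the path up to time `t`. -/
abbrev past (W : ℝ≥0 → S → ℝ) (t : ℝ≥0) : MeasurableSpace S :=
  MeasurableSpace.comap (fun s (u : Set.Iic t) => W u s) inferInstance

/-- The σ-algebra generated by the increments after time `t`. -/
abbrev future (W : ℝ≥0 → S → ℝ) (t : ℝ≥0) : MeasurableSpace S :=
  MeasurableSpace.comap (fun s (v : ℝ≥0) => W (t + v) s - W t s) inferInstance

lemma indep_future_past (hW : IsRegularBrownian W Pr) (t : ℝ≥0) :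
    Indep (future W t) (past W t) Pr :=
  hW.isPreBrownian.indepFun_shift t

lemma measurable_past {S : Type*} (W : ℝ≥0 → S → ℝ) {u t : ℝ≥0} (h : u ≤ t) : Measurable[past W t] (W u) :=
  (measurable_pi_apply (⟨u, h⟩ : Set.Iic t)).comp
    (comap_measurable fun s (u : Set.Iic t) => W u s)

lemma measurable_future {S : Type*} (W : ℝ≥0 → S → ℝ) (t v : ℝ≥0) :
    Measurable[future W t] fun s => W (t + v) s - W t s :=
  (measurable_pi_apply v).comp (comap_measurable fun s (v : ℝ≥0) => W (t + v) s - W t s)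

/-- Freezing the driving path at time `t` does not change the absorbed position at `t`, and the
frozen process is measurable for the past. -/
lemma measurable_absorbed_past (hW : IsRegularBrownian W Pr) (x : ℝ) (t : ℝ≥0) :
    Measurable[past W t] (absorbed W x t) := by
  have hc (s : S) : Continuous fun u => W (min u t) s := by
    have := hW.continuous_path s
    fun_prop
  have h : absorbed W x t = fun s => absorbed (fun u s => W (min u t) s) x t s := by
    ext s
    exact absorbed_congr (hW.continuous_path s) (hc s) fun u hu => by rw [min_eq_left hu]
  rw [h]
  let _ := past W t
  exact (measurable_absorbed hc fun u => measurable_past W (min_le_right u t)).comp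
    (measurable_const.prodMk (measurable_const.prodMk measurable_id))

end IsRegularBrownian

/-- The semigroup `T_t F(x) = E F(X_t)` of the absorbed Brownian motion `X` started at `x`. -/
noncomputable def semigroup (Pr : Measure S) (W : ℝ≥0 → S → ℝ) (t : ℝ≥0) (F : ℝ → ℝ≥0∞) (x : ℝ) :
    ℝ≥0∞ :=
  ∫⁻ s, F (absorbed W x t s) ∂Pr

/-! ### Measurability and Markov property of the absorbed semigroup. -/

namespace IsRegularBrownian

lemma measurable_absorbed_const (hW : IsRegularBrownian W Pr) (x : ℝ) (t : ℝ≥0) :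
    Measurable (absorbed W x t) :=
  (measurable_absorbed hW.continuous_path hW.measurable).comp
    (measurable_const.prodMk (measurable_const.prodMk measurable_id))

lemma measurable_semigroup (hW : IsRegularBrownian W Pr) {F : ℝ → ℝ≥0∞} (hF : Measurable F) :
    Measurable fun p : ℝ≥0 × ℝ => semigroup Pr W p.1 F p.2 := by
  have := hW.isProbabilityMeasure
  have := (hF.comp (measurable_absorbed hW.continuous_path hW.measurable))
  exact Measurable.lintegral_prod_right' (f := fun q : (ℝ≥0 × ℝ) × S =>
    F (absorbed W q.1.2 q.1.1 q.2))
    (this.comp (measurable_fst.fst.prodMk (measurable_fst.snd.prodMk measurable_snd)))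

lemma measurable_semigroup_right (hW : IsRegularBrownian W Pr) {F : ℝ → ℝ≥0∞} (hF : Measurable F)
    (t : ℝ≥0) : Measurable (semigroup Pr W t F) :=
  (hW.measurable_semigroup hF).comp measurable_prodMk_left

/-- The Markov property of the absorbed Brownian motion. -/
lemma semigroup_add (hW : IsRegularBrownian W Pr) {F : ℝ → ℝ≥0∞} (hF : Measurable F)
    (t r : ℝ≥0) (x : ℝ) :
    semigroup Pr W (t + r) F x = semigroup Pr W t (semigroup Pr W r F) x := by
  have := hW.isProbabilityMeasure
  have hV := hW.shift t
  set V : ℝ≥0 → S → ℝ := fun v s => W (t + v) s - W t s with hVdef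
  have hX := hW.measurable_absorbed_const x t
  have hp := measurable_pathMap hV.continuous_path hV.measurable
  -- The position at time `t` depends on the past and the restarted driving path on the later
  -- increments. With the flow property `absorbed_add`, this independence yields the Markov
  -- property.
  have hind : IndepFun (absorbed W x t) (pathMap V hV.continuous_path) Pr := by
    refine (indep_of_indep_of_le_left (indep_of_indep_of_le_right
      (hW.indep_future_past t) (hW.measurable_absorbed_past x t).comap_le) ?_).symm
    refine Measurable.comap_le ?_
    let _ := future W t
    exact measurable_pathMap _ (measurable_future W t)
  have hG : Measurable fun p : ℝ × PathSpace => F (absorbed coord p.1 r p.2) :=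
    hF.comp (measurable_absorbed_coord.comp (measurable_const.prodMk measurable_id))
  calc semigroup Pr W (t + r) F x
      = ∫⁻ s, F (absorbed coord (absorbed W x t s) r (pathMap V hV.continuous_path s)) ∂Pr :=
        lintegral_congr fun s => by rw [absorbed_add (hW.continuous_path s)]; rfl
    _ = ∫⁻ p, F (absorbed coord p.1 r p.2)
          ∂Pr.map fun s => (absorbed W x t s, pathMap V hV.continuous_path s) :=
        (lintegral_map hG (hX.prodMk hp)).symm
    _ = ∫⁻ y, ∫⁻ w, F (absorbed coord y r w) ∂Pr.map (pathMap V hV.continuous_path)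
          ∂Pr.map (absorbed W x t) := by
        rw [(indepFun_iff_map_prod_eq_prod_map_map hX.aemeasurable hp.aemeasurable).1 hind,
          lintegral_prod _ hG.aemeasurable]
    _ = ∫⁻ y, semigroup Pr V r F y ∂Pr.map (absorbed W x t) :=
        lintegral_congr fun y => lintegral_map (hG.comp measurable_prodMk_left) hp
    _ = ∫⁻ y, semigroup Pr W r F y ∂Pr.map (absorbed W x t) :=
        lintegral_congr fun y => lintegral_absorbed_eq hV hW hF y r
    _ = semigroup Pr W t (semigroup Pr W r F) x :=
        lintegral_map (hW.measurable_semigroup_right hF r) hX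

end IsRegularBrownian

end BrownianGas

namespace BrownianGas

open Filter Topology

variable {S : Type*} [MeasurableSpace S] {Pr : Measure S} {W : ℝ≥0 → S → ℝ}

namespace IsRegularBrownian

/-! ### Time reversal and symmetry of the semigroup -/

/-- The time reversal at time `t` of a Brownian path, continued after `t` by the increments. -/
def reversal (W : ℝ≥0 → S → ℝ) (t r : ℝ≥0) (s : S) : ℝ :=
  W (t - r) s - W t s + (W (max r t) s - W t s)

/-- A centred Gaussian process with covariance `min` is a Brownian motion. Only times up to `t`
matter later: there the second difference in `reversal` vanishes; after `t`, truncated subtraction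
freezes the first one. -/
lemma isRegularBrownian_reversal (hW : IsRegularBrownian W Pr) (t : ℝ≥0) :
    IsRegularBrownian (reversal W t) Pr where
  continuous_path s := by
    have := hW.continuous_path s
    unfold reversal
    fun_prop
  measurable r := ((hW.measurable _).sub (hW.measurable _)).add
    ((hW.measurable _).sub (hW.measurable _))
  zero s := by simp [reversal]
  isPreBrownian := by
    have hB := hW.isPreBrownian
    have := hW.isProbabilityMeasure
    have hL2 (u : ℝ≥0) : MemLp (W u) 2 Pr := (hB.isGaussianProcess.hasGaussianLaw_eval u).memLp_two
    have hi (u : ℝ≥0) : Integrable (W u) Pr := hB.integrable_eval u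
    refine IsGaussianProcess.isPreBrownianReal_of_covariance ?_ (fun r => ?_) fun q r hqr => ?_
    · refine hB.isGaussianProcess.of_isGaussianProcess fun r => ?_
      exact ⟨{t - r, t, max r t},
        { toFun x := x ⟨t - r, by simp⟩ - x ⟨t, by simp⟩ + (x ⟨max r t, by simp⟩ - x ⟨t, by simp⟩)
          map_add' x y := by simp; abel
          map_smul' c x := by simp; ring }, fun s => rfl⟩
    · unfold reversal
      rw [integral_add (f := fun s => W (t - r) s - W t s) (g := fun s => W (max r t) s - W t s)
        ((hi _).sub (hi _)) ((hi _).sub (hi _)), integral_sub (hi _) (hi _),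
        integral_sub (hi _) (hi _), hB.integral_eval, hB.integral_eval, hB.integral_eval]
      simp
    · have hfun (r : ℝ≥0) : reversal W t r = (W (t - r) - W t) + (W (max r t) - W t) := rfl
      have hd (u v : ℝ≥0) : MemLp (W u - W v) 2 Pr := (hL2 u).sub (hL2 v)
      have hcov (a b : ℝ≥0) : cov[W a, W b; Pr] = min (a : ℝ) b := by
        rw [hB.covariance_eval, NNReal.coe_min]
      rw [hfun, hfun, covariance_add_left (hd _ _) (hd _ _) ((hd _ _).add (hd _ _)),
        covariance_add_right (hd _ _) (hd _ _) (hd _ _),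
        covariance_add_right (hd _ _) (hd _ _) (hd _ _)]
      simp only [covariance_sub_left (hL2 _) (hL2 _) (hd _ _),
        covariance_sub_right (hL2 _) (hL2 _) (hL2 _), hcov]
      have hqr' : (q : ℝ) ≤ r := hqr
      have hq0 := q.coe_nonneg
      have ht0 := t.coe_nonneg
      rw [NNReal.coe_sub_def, NNReal.coe_sub_def, NNReal.coe_max, NNReal.coe_max]
      grind

/-- Started from `x + W_t`, the reversed path visits the same positions backwards and ends at `x`.
Both paths survive on the same event, and their endpoints are exchanged. -/
lemma zeroExt_mul_absorbed (hW : IsRegularBrownian W Pr) (a f : I01 → ℝ≥0∞) (t : ℝ≥0) (s : S)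
    (x : ℝ) :
    zeroExt a x * zeroExt f (absorbed W x t s) =
      zeroExt f (x + W t s) * zeroExt a (absorbed (reversal W t) (x + W t s) t s) := by
  have hc := hW.continuous_path s
  have hc' := (hW.isRegularBrownian_reversal t).continuous_path s
  have hrev (u : ℝ≥0) (hu : u ≤ t) : x + W t s + reversal W t u s = x + W (t - u) s := by
    rw [reversal, max_eq_right hu]
    ring
  have hiff : (∀ u ≤ t, x + W t s + reversal W t u s ∈ Set.Ioo (0 : ℝ) 1) ↔
      ∀ u ≤ t, x + W u s ∈ Set.Ioo (0 : ℝ) 1 := by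
    refine ⟨fun h u hu => ?_, fun h u hu => ?_⟩
    · have := h (t - u) tsub_le_self
      rwa [hrev _ tsub_le_self, tsub_tsub_cancel_of_le hu] at this
    · rw [hrev u hu]
      exact h _ tsub_le_self
  by_cases h : ∀ u ≤ t, x + W u s ∈ Set.Ioo (0 : ℝ) 1
  · rw [absorbed_of_survive hc h, absorbed_of_survive hc' (hiff.2 h), hrev t le_rfl, tsub_self,
      hW.zero, add_zero, mul_comm]
  · rw [zeroExt_of_notMem f ((absorbed_mem_Ioo_iff hc).not.2 h),
      zeroExt_of_notMem a ((absorbed_mem_Ioo_iff hc').not.2 (hiff.not.2 h)), mul_zero, mul_zero]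

/-- The semigroup of the Brownian motion killed outside `(0,1)` is symmetric with respect to the
Lebesgue measure. -/
lemma lintegral_mul_semigroup_comm (hW : IsRegularBrownian W Pr) {a f : I01 → ℝ≥0∞}
    (ha : Measurable a) (hf : Measurable f) (t : ℝ≥0) :
    ∫⁻ x, zeroExt a x * semigroup Pr W t (zeroExt f) x =
      ∫⁻ x, zeroExt f x * semigroup Pr W t (zeroExt a) x := by
  have := hW.isProbabilityMeasure
  have hZ := hW.isRegularBrownian_reversal t
  have hae := measurable_zeroExt ha
  have hfe := measurable_zeroExt hf
  have hmeas {V : ℝ≥0 → S → ℝ} (hV : IsRegularBrownian V Pr) {a f : I01 → ℝ≥0∞}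
      (ha : Measurable a) (hf : Measurable f) :
      Measurable fun p : ℝ × S => zeroExt a p.1 * zeroExt f (absorbed V p.1 t p.2) :=
    ((measurable_zeroExt ha).comp measurable_fst).mul ((measurable_zeroExt hf).comp
      ((measurable_absorbed hV.continuous_path hV.measurable).comp
        (measurable_const.prodMk measurable_id)))
  have hexp {V : ℝ≥0 → S → ℝ} (hV : IsRegularBrownian V Pr) {a f : I01 → ℝ≥0∞}
      (ha : Measurable a) (hf : Measurable f) :
      ∫⁻ x, zeroExt a x * semigroup Pr V t (zeroExt f) x =
        ∫⁻ s, (∫⁻ x, zeroExt a x * zeroExt f (absorbed V x t s)) ∂Pr := by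
    rw [← lintegral_lintegral_swap (hmeas hV ha hf).aemeasurable]
    refine lintegral_congr fun x => ?_
    exact (lintegral_const_mul _
      ((measurable_zeroExt hf).comp (hV.measurable_absorbed_const x t))).symm
  calc ∫⁻ x, zeroExt a x * semigroup Pr W t (zeroExt f) x
      = ∫⁻ s, (∫⁻ x, zeroExt f (x + W t s) *
          zeroExt a (absorbed (reversal W t) (x + W t s) t s)) ∂Pr := by
        rw [hexp hW ha hf]
        simp_rw [hW.zeroExt_mul_absorbed a f t]
    -- For fixed `s`, substitute `y = x + W_t(s)`: Lebesgue measure is translation invariant.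
    _ = ∫⁻ s, (∫⁻ y, zeroExt f y * zeroExt a (absorbed (reversal W t) y t s)) ∂Pr :=
        lintegral_congr fun s => lintegral_add_right_eq_self
          (fun y => zeroExt f y * zeroExt a (absorbed (reversal W t) y t s)) _
    _ = ∫⁻ x, zeroExt f x * semigroup Pr (reversal W t) t (zeroExt a) x := (hexp hZ hf ha).symm
    _ = ∫⁻ x, zeroExt f x * semigroup Pr W t (zeroExt a) x :=
        lintegral_congr fun x => by
          rw [semigroup, lintegral_absorbed_eq hZ hW hae]; rfl

/-! ### The sine eigenfunction -/

lemma integral_sin_mul_eq_zero (hW : IsRegularBrownian W Pr) (u : ℝ≥0) (c : ℝ) :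
    ∫ s, Real.sin (c * W u s) ∂Pr = 0 := by
  have h : ∫ s, Real.sin (c * W u s) ∂Pr = ∫ y, Real.sin (c * y) ∂gaussianReal 0 u := by
    rw [← (hW.isPreBrownian.hasLaw_eval u).map_eq,
      integral_map (hW.measurable u).aemeasurable (by fun_prop)]
  have h2 : ∫ y, Real.sin (c * y) ∂gaussianReal 0 u = ∫ y, Real.sin (c * -y) ∂gaussianReal 0 u := by
    conv_lhs => rw [← neg_zero, ← gaussianReal_map_neg,
      integral_map measurable_neg.aemeasurable (by fun_prop)]
  rw [h]
  simp only [mul_neg, Real.sin_neg, integral_neg] at h2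
  linarith

/-- Conditioning `sin (π (x + W_t))` on the past up to time `u`. -/
lemma integral_sin_mul_past (hW : IsRegularBrownian W Pr) {u t : ℝ≥0} (hut : u ≤ t) (x : ℝ)
    {G : S → ℝ} (hG : Measurable[past W u] G) (hG1 : ∀ s, |G s| ≤ 1) :
    ∫ s, Real.sin (Real.pi * (x + W t s)) * G s ∂Pr =
      (∫ s, Real.sin (Real.pi * (x + W u s)) * G s ∂Pr) *
        ∫ s, Real.cos (Real.pi * (W t s - W u s)) ∂Pr := by
  have := hW.isProbabilityMeasure
  obtain ⟨v, rfl⟩ := exists_add_of_le hut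
  have hle : past W u ≤ ‹MeasurableSpace S› := by
    refine Measurable.comap_le (measurable_pi_lambda _ fun r => hW.measurable _)
  have hI : Measurable[future W u] fun s => W (u + v) s - W u s := measurable_future W u v
  have hIm := (hW.measurable (u + v)).sub (hW.measurable u)
  have hWu := measurable_past W (le_refl u)
  have hind {f g : ℝ → ℝ} (hf : Measurable f) (hg : Measurable g) :
      ∫ s, f (W u s) * G s * g (W (u + v) s - W u s) ∂Pr =
        (∫ s, f (W u s) * G s ∂Pr) * ∫ s, g (W (u + v) s - W u s) ∂Pr := by
    have hA : Measurable[past W u] fun s => f (W u s) * G s := (hf.comp hWu).mul hG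
    have hB : Measurable[future W u] fun s => g (W (u + v) s - W u s) := hg.comp hI
    have : IndepFun (fun s => f (W u s) * G s) (fun s => g (W (u + v) s - W u s)) Pr :=
      (indep_of_indep_of_le_left (indep_of_indep_of_le_right (hW.indep_future_past u)
        hA.comap_le) hB.comap_le).symm
    exact this.integral_fun_mul_eq_mul_integral (hA.mono hle le_rfl).aestronglyMeasurable
      (hg.comp hIm).aestronglyMeasurable
  have hGm : Measurable G := hG.mono hle le_rfl
  have hint {f g : ℝ → ℝ} (hf : Measurable f) (hg : Measurable g) (hf1 : ∀ y, |f y| ≤ 1)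
      (hg1 : ∀ y, |g y| ≤ 1) :
      Integrable (fun s => f (W u s) * G s * g (W (u + v) s - W u s)) Pr := by
    refine .of_bound (((hf.comp (hW.measurable u)).mul hGm).mul
      (hg.comp hIm)).aestronglyMeasurable 1 (ae_of_all _ fun s => ?_)
    rw [Real.norm_eq_abs, abs_mul, abs_mul]
    exact mul_le_one₀ (mul_le_one₀ (hf1 _) (abs_nonneg _) (hG1 s)) (abs_nonneg _) (hg1 _)
  -- The addition formula separates the past from the increment; the term with the sine of the
  -- increment integrates to zero by symmetry.
  have hsplit (s : S) : Real.sin (Real.pi * (x + W (u + v) s)) * G s =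
      Real.sin (Real.pi * (x + W u s)) * G s * Real.cos (Real.pi * (W (u + v) s - W u s)) +
      Real.cos (Real.pi * (x + W u s)) * G s * Real.sin (Real.pi * (W (u + v) s - W u s)) := by
    have : Real.pi * (x + W (u + v) s) =
      Real.pi * (x + W u s) + Real.pi * (W (u + v) s - W u s) := by ring
    rw [this, Real.sin_add]
    ring
  have hms : Measurable fun y => Real.sin (Real.pi * (x + y)) := by fun_prop
  have hmc : Measurable fun y => Real.cos (Real.pi * (x + y)) := by fun_prop
  have hms' : Measurable fun y => Real.sin (Real.pi * y) := by fun_prop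
  have hmc' : Measurable fun y => Real.cos (Real.pi * y) := by fun_prop
  simp_rw [hsplit]
  rw [integral_add
      (hint hms hmc' (fun y => Real.abs_sin_le_one _) fun y => Real.abs_cos_le_one _)
      (hint hmc hms' (fun y => Real.abs_cos_le_one _) fun y => Real.abs_sin_le_one _),
    hind hms hmc', hind hmc hms', (hW.shift u).integral_sin_mul_eq_zero v Real.pi, mul_zero,
    add_zero]

end IsRegularBrownian
end BrownianGas

namespace BrownianGas

open Filter Topology

variable {S : Type*} [MeasurableSpace S] {Pr : Measure S} {W : ℝ≥0 → S → ℝ}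

namespace IsRegularBrownian

/-- The indicator of survival in `(0,1)` up to time `t`. -/
noncomputable def survival (W : ℝ≥0 → S → ℝ) (x : ℝ) (t : ℝ≥0) : S → ℝ :=
  (absorbed W x t ⁻¹' Set.Ioo (0 : ℝ) 1).indicator 1

lemma survival_eq_one_or {S : Type*} (W : ℝ≥0 → S → ℝ) (x : ℝ) (t : ℝ≥0) (s : S) :
    absorbed W x t s ∈ Set.Ioo (0 : ℝ) 1 ∧ survival W x t s = 1 ∨
      absorbed W x t s ∉ Set.Ioo (0 : ℝ) 1 ∧ survival W x t s = 0 := by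
  by_cases h : absorbed W x t s ∈ Set.Ioo (0 : ℝ) 1
  · exact .inl ⟨h, Set.indicator_of_mem (Set.mem_preimage.2 h) _⟩
  · exact .inr ⟨h, Set.indicator_of_notMem (s := absorbed W x t ⁻¹' _) (fun h' => h h') _⟩

lemma survival_anti (hW : IsRegularBrownian W Pr) (x : ℝ) (s : S) {u t : ℝ≥0} (h : u ≤ t) :
    survival W x t s ≤ survival W x u s := by
  rcases survival_eq_one_or W x t s with ⟨h1, h2⟩ | ⟨h1, h2⟩ <;>
    rcases survival_eq_one_or W x u s with ⟨h3, h4⟩ | ⟨h3, h4⟩ <;> rw [h2, h4]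
  · rw [absorbed_mem_Ioo_iff (hW.continuous_path s)] at h1 h3
    exact absurd (fun v hv => h1 v (hv.trans h)) h3
  · exact zero_le_one

lemma measurable_survival_past (hW : IsRegularBrownian W Pr) (x : ℝ) {u t : ℝ≥0} (h : u ≤ t) :
    Measurable[past W t] (survival W x u) := by
  have hle : past W u ≤ past W t := by
    let _ := past W t
    exact Measurable.comap_le (measurable_pi_lambda _ fun r => measurable_past W (r.2.trans h))
  refine Measurable.mono ?_ hle le_rfl
  exact (Measurable.indicator (s := Set.Ioo (0 : ℝ) 1) (f := fun _ => (1 : ℝ)) measurable_const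
    measurableSet_Ioo).comp (hW.measurable_absorbed_past x u)

lemma measurable_survival (hW : IsRegularBrownian W Pr) (x : ℝ) (t : ℝ≥0) :
    Measurable (survival W x t) :=
  measurable_one.indicator ((hW.measurable_absorbed_const x t) measurableSet_Ioo)

/-- The sine of the path, integrated over the event that the path has left `(0,1)` in the time
interval `(u, v]`, discretized at the time `v`. -/
lemma abs_integral_sin_exit_le (hW : IsRegularBrownian W Pr) (x : ℝ) {u v t : ℝ≥0}
    (huv : u ≤ v) (hvt : v ≤ t) :
    |∫ s, Real.sin (Real.pi * (x + W t s)) * (survival W x u s - survival W x v s) ∂Pr| ≤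
      ∫ s, |Real.sin (Real.pi * (x + W v s))| * (survival W x u s - survival W x v s) ∂Pr := by
  have := hW.isProbabilityMeasure
  have hD0 (s : S) : 0 ≤ survival W x u s - survival W x v s :=
    sub_nonneg.2 (hW.survival_anti x s huv)
  have hD1 (s : S) : |survival W x u s - survival W x v s| ≤ 1 := by
    rw [abs_of_nonneg (hD0 s)]
    rcases survival_eq_one_or W x u s with ⟨-, h⟩ | ⟨-, h⟩ <;>
      rcases survival_eq_one_or W x v s with ⟨-, h'⟩ | ⟨-, h'⟩ <;> rw [h, h'] <;> norm_num
  rw [hW.integral_sin_mul_past hvt x (G := fun s => survival W x u s - survival W x v s)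
    ((hW.measurable_survival_past x huv).sub (hW.measurable_survival_past x le_rfl)) hD1, abs_mul]
  have hcos : |∫ s, Real.cos (Real.pi * (W t s - W v s)) ∂Pr| ≤ 1 := by
    have := norm_integral_le_of_norm_le_const (μ := Pr)
      (f := fun s => Real.cos (Real.pi * (W t s - W v s))) (C := 1)
      (ae_of_all _ fun s => Real.abs_cos_le_one _)
    simpa using this
  refine (mul_le_of_le_one_right (abs_nonneg _) hcos).trans (abs_integral_le_integral_abs.trans ?_)
  simp_rw [abs_mul, abs_of_nonneg (hD0 _)]
  exact le_rfl

/-- This takes the place of the strong Markov property at the exit time. The exit event is split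
along a mesh of size `t/(n+1)`, and an exit between consecutive mesh points is handled by
conditioning at the later one. The resulting bound involves `|sin(π(x + W))|` at the first mesh time
not before the exit, which tends to `0` because the sine vanishes at both endpoints. -/
lemma integral_sin_exit_eq_zero (hW : IsRegularBrownian W Pr) {x : ℝ}
    (hx : x ∈ Set.Ioo (0 : ℝ) 1) (t : ℝ≥0) :
    ∫ s, Real.sin (Real.pi * (x + W t s)) * (1 - survival W x t s) ∂Pr = 0 := by
  have := hW.isProbabilityMeasure
  let T (n k : ℕ) : ℝ≥0 := t * k / (n + 1)
  have hTmono (n k : ℕ) : T n k ≤ T n (k + 1) := by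
    simp only [T]; gcongr; simp
  have hTle (n k : ℕ) (hk : k < n + 1) : T n (k + 1) ≤ t := by
    simp only [T]
    rw [div_le_iff₀ (by positivity)]
    gcongr
    exact_mod_cast hk
  let D (n k : ℕ) (s : S) : ℝ := survival W x (T n k) s - survival W x (T n (k + 1)) s
  have hD0 (n k : ℕ) (s : S) : 0 ≤ D n k s := sub_nonneg.2 (hW.survival_anti x s (hTmono n k))
  have hDsum (n : ℕ) (s : S) : ∑ k ∈ Finset.range (n + 1), D n k s = 1 - survival W x t s := by
    rw [Finset.sum_range_sub' (fun k => survival W x (T n k) s)]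
    have h0 : T n 0 = 0 := by simp [T]
    have h1 : T n (n + 1) = t := by
      simp only [T]
      push_cast
      field_simp
    rw [h0, h1]
    congr 1
    rcases survival_eq_one_or W x 0 s with ⟨-, h⟩ | ⟨h, -⟩
    · exact h
    · rw [absorbed_zero (hW.continuous_path s), hW.zero, add_zero] at h
      exact absurd hx h
  have hs01 (u : ℝ≥0) (s : S) : 0 ≤ survival W x u s ∧ survival W x u s ≤ 1 := by
    rcases survival_eq_one_or W x u s with ⟨-, h⟩ | ⟨-, h⟩ <;> rw [h] <;> norm_num
  have hDm (n k : ℕ) : Measurable (D n k) :=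
    (hW.measurable_survival x _).sub (hW.measurable_survival x _)
  have hD1 (n k : ℕ) (s : S) : |D n k s| ≤ 1 := by
    rw [abs_of_nonneg (hD0 n k s)]
    linarith [(hs01 (T n k) s).2, (hs01 (T n (k + 1)) s).1]
  have hsm (u : ℝ≥0) : Measurable fun s => Real.sin (Real.pi * (x + W u s)) := by
    have := hW.measurable u
    fun_prop
  let H (n : ℕ) (s : S) : ℝ :=
    ∑ k ∈ Finset.range (n + 1), |Real.sin (Real.pi * (x + W (T n (k + 1)) s))| * D n k s
  have hH0 (n : ℕ) (s : S) : 0 ≤ H n s :=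
    Finset.sum_nonneg fun k _ => mul_nonneg (abs_nonneg _) (hD0 n k s)
  have hHle (n : ℕ) (s : S) : H n s ≤ 1 - survival W x t s := by
    rw [← hDsum n s]
    exact Finset.sum_le_sum fun k _ => mul_le_of_le_one_left (hD0 n k s) (Real.abs_sin_le_one _)
  have hHm (n : ℕ) : Measurable (H n) := by
    have := hDm n
    have := fun k => hsm (T n (k + 1))
    fun_prop
  have hint {g G : S → ℝ} (hg : Measurable g) (hG : Measurable G) (hg1 : ∀ s, |g s| ≤ 1)
      (hG1 : ∀ s, |G s| ≤ 1) : Integrable (fun s => g s * G s) Pr := by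
    refine .of_bound (hg.mul hG).aestronglyMeasurable 1 (ae_of_all _ fun s => ?_)
    rw [Real.norm_eq_abs, abs_mul]
    exact mul_le_one₀ (hg1 s) (abs_nonneg _) (hG1 s)
  have hbound (n : ℕ) : |∫ s, Real.sin (Real.pi * (x + W t s)) * (1 - survival W x t s) ∂Pr| ≤
      ∫ s, H n s ∂Pr := by
    simp_rw [← hDsum n, Finset.mul_sum]
    rw [integral_finsetSum _ fun k _ => hint (hsm t) (hDm n k) (fun s => Real.abs_sin_le_one _)
      (hD1 n k), integral_finsetSum _ fun k _ => hint (hsm _).abs (hDm n k)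
      (fun s => by rw [abs_abs]; exact Real.abs_sin_le_one _) (hD1 n k)]
    refine (Finset.abs_sum_le_sum_abs _ _).trans (Finset.sum_le_sum fun k hk => ?_)
    exact hW.abs_integral_sin_exit_le x (hTmono n k) (hTle n k (Finset.mem_range.1 hk))
  have hlim (s : S) : Tendsto (fun n => H n s) atTop (𝓝 0) := by
    have hc := hW.continuous_path s
    rcases survival_eq_one_or W x t s with ⟨-, h⟩ | ⟨hex, -⟩
    · refine tendsto_const_nhds.congr fun n => le_antisymm (hH0 n s) ?_
      simpa [h] using hHle n s
    set σ := exitMin W x t s with hσ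
    have hσex : x + W σ s ∉ Set.Ioo (0 : ℝ) 1 := hex
    have hzero : Real.sin (Real.pi * (x + W σ s)) = 0 := by
      have hIcc : x + W σ s ∈ Set.Icc (0 : ℝ) 1 :=
        absorbed_mem_Icc hc (hW.zero s) ⟨hx.1.le, hx.2.le⟩ t
      have : x + W σ s = 0 ∨ x + W σ s = 1 := by
        by_contra! hne
        exact hσex ⟨lt_of_le_of_ne hIcc.1 hne.1.symm, lt_of_le_of_ne hIcc.2 hne.2⟩
      rcases this with h | h <;> simp [h]
    rw [Metric.tendsto_atTop]
    intro ε hε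
    have hcont : Continuous fun u => Real.sin (Real.pi * (x + W u s)) := by fun_prop
    obtain ⟨δ, hδ, hδε⟩ := Metric.continuous_iff.1 hcont σ (ε / 2) (by positivity)
    obtain ⟨N, hN⟩ := exists_nat_gt ((t : ℝ) / δ)
    refine ⟨N, fun n hn => ?_⟩
    have hmesh : (t : ℝ) / (n + 1) < δ := by
      rw [div_lt_iff₀ hδ] at hN
      rw [div_lt_iff₀ (by positivity)]
      have : (N : ℝ) ≤ n := by exact_mod_cast hn
      nlinarith
    rw [Real.dist_0_eq_abs, abs_of_nonneg (hH0 n s)]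
    refine lt_of_le_of_lt ?_ (half_lt_self hε)
    calc H n s ≤ ∑ k ∈ Finset.range (n + 1), ε / 2 * D n k s := by
          refine Finset.sum_le_sum fun k _ => ?_
          -- A nonzero `D n k s` means survival at `T n k` but not at `T n (k + 1)`, so the exit
          -- time `σ` lies between them and is within `δ` of the latter.
          rcases (hD0 n k s).eq_or_lt with h0 | hpos
          · rw [← h0, mul_zero, mul_zero]
          refine mul_le_mul_of_nonneg_right ?_ hpos.le
          have hk : absorbed W x (T n k) s ∈ Set.Ioo (0 : ℝ) 1 := by
            rcases survival_eq_one_or W x (T n k) s with ⟨h, -⟩ | ⟨-, h⟩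
            · exact h
            · simp only [D, h] at hpos
              linarith [(hs01 (T n (k + 1)) s).1]
          have hk' : absorbed W x (T n (k + 1)) s ∉ Set.Ioo (0 : ℝ) 1 := by
            rcases survival_eq_one_or W x (T n (k + 1)) s with ⟨-, h⟩ | ⟨h, -⟩
            · simp only [D, h] at hpos
              linarith [(hs01 (T n k) s).2]
            · exact h
          have h1 : T n k ≤ σ := by
            by_contra! hlt
            exact hσex ((absorbed_mem_Ioo_iff hc).1 hk σ hlt.le)
          have h2 : σ ≤ T n (k + 1) := by
            rw [absorbed_mem_Ioo_iff hc] at hk'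
            push Not at hk'
            exact (exitMin_le_iff hc t _).2 (.inr hk')
          have hdist : dist (T n (k + 1)) σ < δ := by
            refine lt_of_le_of_lt ?_ hmesh
            have h1' : (T n k : ℝ) ≤ σ := h1
            have h2' : (σ : ℝ) ≤ T n (k + 1) := h2
            rw [NNReal.dist_eq, abs_of_nonneg (sub_nonneg.2 h2')]
            have : (T n (k + 1) : ℝ) = T n k + t / (n + 1) := by
              simp only [T]
              push_cast
              field_simp
            linarith
          have := hδε _ hdist
          rw [hzero, Real.dist_0_eq_abs] at this
          exact this.le
      _ = ε / 2 * (1 - survival W x t s) := by rw [← Finset.mul_sum, hDsum]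
      _ ≤ ε / 2 := mul_le_of_le_one_right (by positivity) (by linarith [(hs01 t s).1])
  have hint0 : Tendsto (fun n => ∫ s, H n s ∂Pr) atTop (𝓝 (∫ _, (0 : ℝ) ∂Pr)) := by
    refine tendsto_integral_of_dominated_convergence (fun _ => 1)
      (fun n => (hHm n).aestronglyMeasurable) (by simp) (fun n => ae_of_all _ fun s => ?_)
      (ae_of_all _ hlim)
    rw [Real.norm_eq_abs, abs_of_nonneg (hH0 n s)]
    linarith [hHle n s, (hs01 t s).1]
  rw [integral_zero] at hint0
  exact abs_eq_zero.1 (le_antisymm (ge_of_tendsto' hint0 hbound) (abs_nonneg _))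

/-- The function `x ↦ sin (π x)` is excessive for the killed semigroup. -/
lemma semigroup_sin_le (hW : IsRegularBrownian W Pr) (x : I01) (t : ℝ≥0) :
    semigroup Pr W t (zeroExt fun y => ENNReal.ofReal (Real.sin (Real.pi * y))) x ≤
      ENNReal.ofReal (Real.sin (Real.pi * x)) := by
  have := hW.isProbabilityMeasure
  have hsin (y : I01) : 0 ≤ Real.sin (Real.pi * y) := by
    refine Real.sin_nonneg_of_nonneg_of_le_pi (mul_nonneg Real.pi_pos.le y.2.1.le) ?_
    exact mul_le_of_le_one_right Real.pi_pos.le y.2.2.le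
  have hpt (s : S) : zeroExt (fun y => ENNReal.ofReal (Real.sin (Real.pi * y)))
      (absorbed W x t s) =
      ENNReal.ofReal (Real.sin (Real.pi * (x + W t s)) * survival W x t s) := by
    rcases survival_eq_one_or W x t s with ⟨h, h'⟩ | ⟨h, h'⟩
    · rw [h', mul_one, ← absorbed_of_survive (hW.continuous_path s)
        ((absorbed_mem_Ioo_iff (hW.continuous_path s)).1 h)]
      exact zeroExt_coe _ ⟨_, h⟩
    · rw [h', zeroExt_of_notMem _ h]
      simp
  have hnn (s : S) : 0 ≤ Real.sin (Real.pi * (x + W t s)) * survival W x t s := by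
    rcases survival_eq_one_or W x t s with ⟨h, h'⟩ | ⟨h, h'⟩
    · rw [h', mul_one, ← absorbed_of_survive (hW.continuous_path s)
        ((absorbed_mem_Ioo_iff (hW.continuous_path s)).1 h)]
      exact hsin ⟨_, h⟩
    · rw [h', mul_zero]
  have hsm : Measurable fun s => Real.sin (Real.pi * (x + W t s)) := by
    have := hW.measurable t
    fun_prop
  have hi1 : Integrable (fun s => Real.sin (Real.pi * (x + W t s))) Pr :=
    .of_bound hsm.aestronglyMeasurable 1 (ae_of_all _ fun s => Real.abs_sin_le_one _)
  have hi2 : Integrable (fun s => Real.sin (Real.pi * (x + W t s)) * survival W x t s) Pr := by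
    refine hi1.mul_bdd (c := 1) (hW.measurable_survival x t).aestronglyMeasurable
      (ae_of_all _ fun s => ?_)
    rcases survival_eq_one_or W x t s with ⟨-, h⟩ | ⟨-, h⟩ <;> rw [h] <;> norm_num
  rw [semigroup, lintegral_congr hpt, ← ofReal_integral_eq_lintegral_ofReal hi2 (ae_of_all _ hnn)]
  refine ENNReal.ofReal_le_ofReal ?_
  -- Paths that have exited contribute nothing, so the integral over survivors is the full one.
  -- Conditioning at time `0` evaluates it as `sin(πx) · E cos(πW_t)`.
  have hz := hW.integral_sin_exit_eq_zero x.2 t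
  simp_rw [mul_sub, mul_one] at hz
  rw [integral_sub hi1 hi2, sub_eq_zero] at hz
  have h0 := hW.integral_sin_mul_past (zero_le (a := t)) x (G := fun _ => 1) measurable_const
    (by simp)
  simp only [mul_one, hW.zero, add_zero, sub_zero, integral_const, probReal_univ,
    one_smul] at h0
  rw [← hz, h0]
  refine mul_le_of_le_one_right (hsin x) ?_
  have := norm_integral_le_of_norm_le_const (μ := Pr)
    (f := fun s => Real.cos (Real.pi * W t s)) (C := 1)
    (ae_of_all _ fun s => Real.abs_cos_le_one _)
  exact (le_abs_self _).trans (by simpa using this)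

end IsRegularBrownian
end BrownianGas

namespace BrownianGas

open Filter Topology BrownianGas.Configuration

variable {S : Type*} [MeasurableSpace S] {Pr : Measure S} {W : ℝ≥0 → S → ℝ}

/-! ### The law of independent absorbed Brownian motions -/

/-- The constant is the product of `sin(πy) ≤ π min(y, 1 - y)` and `min(y, 1 - y) ≤ 2 m(y)`. -/
lemma sin_pi_mul_le (y : I01) : Real.sin (Real.pi * y) ≤ 2 * Real.pi * m y := by
  have h1 : Real.sin (Real.pi * y) ≤ Real.pi * y :=
    Real.sin_le (mul_nonneg Real.pi_pos.le y.2.1.le)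
  have h2 : Real.sin (Real.pi * y) ≤ Real.pi * (1 - y) := by
    rw [← Real.sin_pi_sub, show Real.pi - Real.pi * y = Real.pi * (1 - y) by ring]
    exact Real.sin_le (mul_nonneg Real.pi_pos.le (sub_nonneg.2 y.2.2.le))
  have h3 := min_le_two_mul_m y
  have h4 : Real.sin (Real.pi * y) ≤ Real.pi * min (y : ℝ) (1 - y) := by
    rw [mul_min_of_nonneg _ _ Real.pi_pos.le]
    exact le_min h1 h2
  nlinarith [Real.pi_pos]

/-- Jordan's inequality `sin(πz) ≥ 2z` on `[0, 1/2]`, applied to `y` or to `1 - y`. -/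
lemma m_le_sin_pi_mul (y : I01) : m y ≤ Real.sin (Real.pi * y) := by
  have key {z : ℝ} (h0 : 0 ≤ z) (h1 : z ≤ 1 / 2) : 2 * z ≤ Real.sin (Real.pi * z) := by
    have := Real.mul_le_sin (x := Real.pi * z) (by positivity) (by nlinarith [Real.pi_pos])
    refine le_trans (le_of_eq ?_) this
    field_simp
  obtain ⟨h0, h1⟩ := y.2
  unfold m
  rcases le_total (y : ℝ) (1 / 2) with h | h
  · have := key h0.le h
    nlinarith
  · have := key (z := 1 - y) (by linarith) (by linarith)
    rw [show Real.pi * (1 - (y : ℝ)) = Real.pi - Real.pi * y by ring, Real.sin_pi_sub] at this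
    nlinarith

lemma zeroExt_mono {f g : I01 → ℝ≥0∞} (h : ∀ x, f x ≤ g x) (y : ℝ) :
    zeroExt f y ≤ zeroExt g y := by
  by_cases hy : y ∈ Set.Ioo (0 : ℝ) 1
  · simpa using (zeroExt_coe f ⟨y, hy⟩).trans_le ((h ⟨y, hy⟩).trans_eq (zeroExt_coe g ⟨y, hy⟩).symm)
  · rw [zeroExt_of_notMem f hy]
    exact zero_le

lemma lintegral_eval_infinitePi {ι : Type*} [IsProbabilityMeasure Pr] {f : S → ℝ≥0∞}
    (hf : Measurable f) (i : ι) :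
    ∫⁻ w, f (w i) ∂Measure.infinitePi (fun _ : ι => Pr) = ∫⁻ s, f s ∂Pr :=
  (measurePreserving_eval_infinitePi (fun _ : ι => Pr) i).lintegral_comp hf

lemma lintegral_prod_infinitePi {ι : Type*} [IsProbabilityMeasure Pr]
    {f : ι → S → ℝ≥0∞} (hf : ∀ i, Measurable (f i)) (F : Finset ι) :
    ∫⁻ w, ∏ i ∈ F, f i (w i) ∂Measure.infinitePi (fun _ : ι => Pr) =
      ∏ i ∈ F, ∫⁻ s, f i s ∂Pr := by
  have h := lintegral_prod_eq_prod_lintegral_of_indepFun F (fun i (w : ι → S) => f i (w i))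
    (iIndepFun_infinitePi (P := fun _ => Pr) hf) fun i => (hf i).comp (measurable_pi_apply i)
  rw [h]
  exact Finset.prod_congr rfl fun i _ => lintegral_eval_infinitePi (hf i) i

/-- Independence gives the formula for finite products; the limit over finite subsets is dominated
by `1`. Writing each factor as `e^{-(-log ·)}` turns the infinite product into a sum. -/
lemma lintegral_expNeg_tsum_infinitePi {ι : Type*} [Countable ι] [IsProbabilityMeasure Pr]
    {f : ι → S → ℝ≥0∞} (hf : ∀ i, Measurable (f i)) :
    ∫⁻ w, expNeg (∑' i, f i (w i)) ∂Measure.infinitePi (fun _ : ι => Pr) =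
      expNeg (∑' i, negLog (∫⁻ s, expNeg (f i s) ∂Pr)) := by
  have hY (i : ι) : Measurable fun s => expNeg (f i s) := measurable_expNeg.comp (hf i)
  have hY' (i : ι) : Measurable fun w : ι → S => expNeg (f i (w i)) :=
    (hY i).comp (measurable_pi_apply i)
  have hprod (F : Finset ι) :
      ∫⁻ w, ∏ i ∈ F, expNeg (f i (w i)) ∂Measure.infinitePi (fun _ : ι => Pr) =
        ∏ i ∈ F, expNeg (negLog (∫⁻ s, expNeg (f i s) ∂Pr)) := by
    rw [lintegral_prod_infinitePi hY F]
    refine Finset.prod_congr rfl fun i _ => ?_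
    rw [expNeg_negLog]
    exact (lintegral_mono fun _ => expNeg_le_one _).trans (by simp)
  have hlim : Tendsto
      (fun F : Finset ι => ∫⁻ w, ∏ i ∈ F, expNeg (f i (w i)) ∂Measure.infinitePi (fun _ : ι => Pr))
      atTop (𝓝 (∫⁻ w, expNeg (∑' i, f i (w i)) ∂Measure.infinitePi (fun _ : ι => Pr))) := by
    refine tendsto_lintegral_filter_of_dominated_convergence (fun _ => 1)
      (.of_forall fun F => Finset.measurable_fun_prod F fun i _ => hY' i)
      (.of_forall fun F => ae_of_all _ fun w => ?_) (by simp)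
      (ae_of_all _ fun w => tendsto_prod_expNeg _)
    exact Finset.prod_le_one' fun i _ => expNeg_le_one _
  simp_rw [hprod] at hlim
  exact tendsto_nhds_unique hlim (tendsto_prod_expNeg _)

/-- The nonlinear evolution `V_t g(x) = -log E e^{-g(X_t)}`, with `X` the absorbed Brownian motion
started at `x`, and `g` extended by zero outside `(0,1)`. -/
noncomputable def evolve (Pr : Measure S) (W : ℝ≥0 → S → ℝ) (t : ℝ≥0) (g : I01 → ℝ≥0∞) (x : I01) :
    ℝ≥0∞ :=
  negLog (semigroup Pr W t (fun y => expNeg (zeroExt g y)) x)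

namespace IsRegularBrownian

lemma semigroup_m_le (hW : IsRegularBrownian W Pr) (x : I01) (t : ℝ≥0) :
    semigroup Pr W t (zeroExt fun y => ENNReal.ofReal (m y)) x ≤
      ENNReal.ofReal (2 * Real.pi) * ENNReal.ofReal (m x) := by
  calc semigroup Pr W t (zeroExt fun y => ENNReal.ofReal (m y)) x
      ≤ semigroup Pr W t (zeroExt fun y => ENNReal.ofReal (Real.sin (Real.pi * y))) x :=
        lintegral_mono fun s => zeroExt_mono
          (fun y => ENNReal.ofReal_le_ofReal (m_le_sin_pi_mul y)) _
    _ ≤ ENNReal.ofReal (Real.sin (Real.pi * x)) := hW.semigroup_sin_le x t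
    _ ≤ ENNReal.ofReal (2 * Real.pi * m x) := ENNReal.ofReal_le_ofReal (sin_pi_mul_le x)
    _ = _ := ENNReal.ofReal_mul (by positivity)

lemma measurable_absorbed_eval (hW : IsRegularBrownian W Pr) (t : ℝ≥0) (ω : Configuration)
    (p : ω.Particle) :
    Measurable fun w : ω.Particle → S => absorbed W p.pos t (w p) :=
  (hW.measurable_absorbed_const p.pos t).comp (measurable_pi_apply p)

/-- The mean total weight is at most `2π ω(m) < ∞`. Hence the default value in `ofPoints` is almost
surely not used. -/
lemma ae_totalWeight_lt_top (hW : IsRegularBrownian W Pr) [IsProbabilityMeasure Pr] (t : ℝ≥0)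
    (ω : Configuration) :
    ∀ᵐ w ∂Measure.infinitePi fun _ : ω.Particle => Pr,
      totalWeight (fun p : ω.Particle => absorbed W p.pos t (w p)) < ∞ := by
  have hm := measurable_zeroExt continuous_ofReal_m.measurable
  refine ae_lt_top (.tsum fun p => hm.comp (hW.measurable_absorbed_eval t ω p)) ?_
  have h1 (p : ω.Particle) : ∫⁻ w, zeroExt (fun y => ENNReal.ofReal (m y))
      (absorbed W p.pos t (w p)) ∂Measure.infinitePi (fun _ : ω.Particle => Pr) =
      semigroup Pr W t (zeroExt fun y => ENNReal.ofReal (m y)) p.pos :=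
    lintegral_eval_infinitePi (hm.comp (hW.measurable_absorbed_const p.pos t)) p
  unfold totalWeight
  rw [lintegral_tsum fun p : ω.Particle =>
    (show Measurable fun w : ω.Particle → S => zeroExt (fun y => ENNReal.ofReal (m y))
      (absorbed W p.pos t (w p)) from hm.comp (hW.measurable_absorbed_eval t ω p)).aemeasurable]
  simp_rw [h1]
  refine ne_top_of_le_ne_top ?_ (ENNReal.tsum_le_tsum fun p => hW.semigroup_m_le p.1 t)
  rw [ENNReal.tsum_mul_left, ← ω.lintegral_eq_tsum_particle fun x => ENNReal.ofReal (m x)]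
  exact ENNReal.mul_ne_top ENNReal.ofReal_ne_top ω.isConfiguration.tempered.ne

lemma measurable_ofPoints_absorbed (hW : IsRegularBrownian W Pr) (t : ℝ≥0) (ω : Configuration) :
    Measurable fun w : ω.Particle → S =>
      ofPoints fun p : ω.Particle => absorbed W p.pos t (w p) :=
  measurable_ofPoints (hW.measurable_absorbed_eval t ω)

lemma isProbabilityMeasure_freeLaw (hW : IsRegularBrownian W Pr) [IsProbabilityMeasure Pr]
    (t : ℝ≥0) (ω : Configuration) : IsProbabilityMeasure (freeLaw Pr W t ω) :=
  Measure.isProbabilityMeasure_map (hW.measurable_ofPoints_absorbed t ω).aemeasurable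

lemma semigroup_le_one [IsProbabilityMeasure Pr] (t : ℝ≥0) {F : ℝ → ℝ≥0∞} (hF : ∀ y, F y ≤ 1)
    (x : ℝ) : semigroup Pr W t F x ≤ 1 :=
  (lintegral_mono fun _ => hF _).trans (by simp)

lemma measurable_expNeg_zeroExt {g : I01 → ℝ≥0∞} (hg : Measurable g) :
    Measurable fun y => expNeg (zeroExt g y) :=
  measurable_expNeg.comp (measurable_zeroExt hg)

lemma expNeg_evolve [IsProbabilityMeasure Pr] (t : ℝ≥0) (g : I01 → ℝ≥0∞) (x : I01) :
    expNeg (evolve Pr W t g x) = semigroup Pr W t (fun y => expNeg (zeroExt g y)) x :=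
  expNeg_negLog (semigroup_le_one t (fun _ => expNeg_le_one _) _)

lemma measurable_evolve (hW : IsRegularBrownian W Pr) {g : I01 → ℝ≥0∞} (hg : Measurable g) :
    Measurable fun p : ℝ≥0 × I01 => evolve Pr W p.1 g p.2 := by
  have h : Measurable fun p : ℝ≥0 × I01 => (p.1, (p.2 : ℝ)) :=
    measurable_fst.prodMk (measurable_subtype_coe.comp measurable_snd)
  have h2 := (hW.measurable_semigroup (measurable_expNeg_zeroExt hg)).comp h
  have h3 := measurable_negLog.comp h2
  exact h3

lemma measurable_evolve_right (hW : IsRegularBrownian W Pr) {g : I01 → ℝ≥0∞} (hg : Measurable g)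
    (t : ℝ≥0) : Measurable (evolve Pr W t g) := by
  have h : Measurable fun x : I01 => (t, x) := measurable_prodMk_left
  have h2 := (hW.measurable_evolve hg).comp h
  exact h2

/-- The Laplace functional of the law of independent absorbed Brownian motions. -/
lemma lintegral_laplaceVar_freeLaw (hW : IsRegularBrownian W Pr) [IsProbabilityMeasure Pr]
    (t : ℝ≥0) (ω : Configuration) {g : I01 → ℝ≥0∞} (hg : Measurable g) :
    ∫⁻ η, laplaceVar g η ∂freeLaw Pr W t ω = laplaceVar (evolve Pr W t g) ω := by
  have hg' (p : ω.Particle) : Measurable fun s => zeroExt g (absorbed W p.pos t s) :=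
    (measurable_zeroExt hg).comp (hW.measurable_absorbed_const p.pos t)
  rw [freeLaw, lintegral_map (measurable_laplaceVar hg) (hW.measurable_ofPoints_absorbed t ω)]
  have hae : ∀ᵐ w ∂Measure.infinitePi fun _ : ω.Particle => Pr,
      laplaceVar g (ofPoints fun p : ω.Particle => absorbed W p.pos t (w p)) =
      expNeg (∑' p : ω.Particle, zeroExt g (absorbed W p.pos t (w p))) := by
    filter_upwards [hW.ae_totalWeight_lt_top t ω] with w hw using laplaceVar_ofPoints hw hg
  rw [lintegral_congr_ae hae, lintegral_expNeg_tsum_infinitePi hg', laplaceVar,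
    ω.lintegral_eq_tsum_particle]
  rfl

end IsRegularBrownian

/-- Absorption is a pathwise operation: a single path is regarded as a process on a one-point space.
-/
lemma absorbed_congr_path {S : Type*} {W W' : ℝ≥0 → S → ℝ} {s : S} (h : ∀ t, W t s = W' t s)
    (x : ℝ) (t : ℝ≥0) : absorbed W x t s = absorbed W' x t s := by
  have h' : (fun t (_ : Unit) => W t s) = fun t _ => W' t s := by
    ext t
    exact h t
  exact congrArg (fun V : ℝ≥0 → Unit → ℝ => absorbed V x t ()) h'

lemma hitTime_congr_path {S : Type*} {W W' : ℝ≥0 → S → ℝ} {s : S} (h : ∀ t, W t s = W' t s)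
    (x a : ℝ) : hitTime W x a s = hitTime W' x a s := by
  have h' : (fun t (_ : Unit) => W t s) = fun t _ => W' t s := by
    ext t
    exact h t
  exact congrArg (fun V : ℝ≥0 → Unit → ℝ => hitTime V x a ()) h'

lemma freeLaw_congr [IsProbabilityMeasure Pr] {W' : ℝ≥0 → S → ℝ}
    (h : ∀ᵐ s ∂Pr, ∀ t, W t s = W' t s) (t : ℝ≥0) (ω : Configuration) :
    freeLaw Pr W t ω = freeLaw Pr W' t ω := by
  refine Measure.map_congr ?_
  have hall : ∀ᵐ w ∂Measure.infinitePi fun _ : ω.Particle => Pr, ∀ p, ∀ t,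
      W t (w p) = W' t (w p) :=
    ae_all_iff.2 fun p => (measurePreserving_eval_infinitePi
      (fun _ : ω.Particle => Pr) p).quasiMeasurePreserving.ae h
  filter_upwards [hall] with w hw
  congr 1
  ext p
  exact absorbed_congr_path (hw p) _ _

lemma injection_congr [IsProbabilityMeasure Pr] {W' : ℝ≥0 → S → ℝ}
    (h : ∀ᵐ s ∂Pr, ∀ t, W t s = W' t s) (lam₀ lam₁ t : ℝ≥0) :
    injection Pr W lam₀ lam₁ t = injection Pr W' lam₀ lam₁ t := by
  have key (x a : ℝ) : Pr {s | hitTime W x a s ≤ (t : WithTop ℝ≥0)} =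
      Pr {s | hitTime W' x a s ≤ (t : WithTop ℝ≥0)} := by
    refine measure_congr (eventuallyEq_set.2 ?_)
    filter_upwards [h] with s hs
    rw [hitTime_congr_path hs]
  simp only [injection, key]

lemma gasLaw_congr [IsProbabilityMeasure Pr] {W' : ℝ≥0 → S → ℝ}
    (h : ∀ᵐ s ∂Pr, ∀ t, W t s = W' t s) (lam₀ lam₁ : ℝ≥0) :
    gasLaw Pr W lam₀ lam₁ = gasLaw Pr W' lam₀ lam₁ := by
  ext t ω : 2
  simp only [gasLaw, injection_congr h, freeLaw_congr h]

end BrownianGas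

namespace BrownianGas

open Filter Topology BrownianGas.Configuration

/-! ### The Laplace functional of the Poisson point process -/

section Poisson

variable (μ : Measure I01) [IsFiniteMeasure μ]

lemma totalWeight_fin_lt_top {n : ℕ} (x : Fin n → I01) :
    totalWeight (fun i => (x i : ℝ)) < ∞ := by
  simp only [totalWeight, zeroExt_coe, tsum_fintype]
  exact ENNReal.sum_lt_top.2 fun i _ => ENNReal.ofReal_lt_top

lemma lintegral_prod_pi {q : I01 → ℝ≥0∞} (hq : Measurable q) (hq1 : ∀ x, q x ≤ 1) (n : ℕ) :
    ∫⁻ x, ∏ i, q (x i) ∂Measure.pi (fun _ : Fin n => μ) = (∫⁻ x, q x ∂μ) ^ n := by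
  have hfin (x : I01) : q x ≠ ∞ := ne_top_of_le_ne_top (by simp) (hq1 x)
  have hQ : ∫⁻ x, q x ∂μ ≠ ∞ :=
    ne_top_of_le_ne_top (measure_ne_top μ .univ) ((lintegral_mono hq1).trans (by simp))
  have hprod (x : Fin n → I01) : ∏ i, q (x i) = ENNReal.ofReal (∏ i, (q (x i)).toReal) := by
    rw [← ENNReal.toReal_prod, ENNReal.ofReal_toReal (ENNReal.prod_ne_top fun i _ => hfin _)]
  have hm : Measurable fun x : Fin n → I01 => ∏ i, (q (x i)).toReal :=
    Finset.measurable_fun_prod _ fun i _ => (hq.comp (measurable_pi_apply i)).ennreal_toReal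
  have hint : Integrable (fun x : Fin n → I01 => ∏ i, (q (x i)).toReal)
      (Measure.pi fun _ : Fin n => μ) := by
    refine .of_bound hm.aestronglyMeasurable 1 (ae_of_all _ fun x => ?_)
    rw [Real.norm_eq_abs, abs_of_nonneg (Finset.prod_nonneg fun i _ => ENNReal.toReal_nonneg)]
    exact Finset.prod_le_one (fun i _ => ENNReal.toReal_nonneg)
      fun i _ => ENNReal.toReal_mono (by simp) (hq1 _)
  simp_rw [hprod]
  rw [← ofReal_integral_eq_lintegral_ofReal hint (ae_of_all _ fun x =>
    Finset.prod_nonneg fun i _ => ENNReal.toReal_nonneg),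
    integral_fintype_prod_eq_pow fun x => (q x).toReal, Fintype.card_fin,
    integral_toReal hq.aemeasurable (ae_of_all _ fun x => (hfin x).lt_top),
    ENNReal.ofReal_pow ENNReal.toReal_nonneg, ENNReal.ofReal_toReal hQ]

/-- With `M = μ(0,1)` and `Q = μ(e^{-g})`, the sum `∑ e^{-M} Qⁿ/n!` equals `e^{-(M - Q)}`, and `M -
Q = μ(1 - e^{-g})`. -/
lemma lintegral_laplaceVar_poissonLaw {g : I01 → ℝ≥0∞} (hg : Measurable g) :
    ∫⁻ η, laplaceVar g η ∂poissonLaw μ = expNeg (∫⁻ x, (1 - expNeg (g x)) ∂μ) := by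
  have hq : Measurable fun x => expNeg (g x) := measurable_expNeg.comp hg
  set Q := ∫⁻ x, expNeg (g x) ∂μ with hQdef
  have hQle : Q ≤ μ Set.univ := (lintegral_mono fun x => expNeg_le_one (g x)).trans (by simp)
  have hM := measure_ne_top μ Set.univ
  have hQ : Q ≠ ∞ := ne_top_of_le_ne_top hM hQle
  have hmeas (n : ℕ) : Measurable fun x : Fin n → I01 => ofPoints fun i => (x i : ℝ) :=
    measurable_ofPoints fun i => measurable_subtype_coe.comp (measurable_pi_apply i)
  have hterm (n : ℕ) : ∫⁻ η, laplaceVar g η ∂(Measure.pi fun _ : Fin n => μ).map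
      (fun x => ofPoints fun i => (x i : ℝ)) = Q ^ n := by
    rw [lintegral_map (measurable_laplaceVar hg) (hmeas n),
      ← lintegral_prod_pi μ hq fun x => expNeg_le_one _]
    refine lintegral_congr fun x => ?_
    rw [laplaceVar_ofPoints (totalWeight_fin_lt_top x) hg, tsum_fintype, expNeg_sum]
    simp
  have hsub : ∫⁻ x, (1 - expNeg (g x)) ∂μ = ENNReal.ofReal (μ.real Set.univ - Q.toReal) := by
    rw [lintegral_sub hq hQ (ae_of_all _ fun x => expNeg_le_one _), lintegral_one,
      ENNReal.ofReal_sub _ ENNReal.toReal_nonneg, Measure.real, ENNReal.ofReal_toReal hM,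
      ENNReal.ofReal_toReal hQ]
  have hQ' : Q.toReal ≤ μ.real Set.univ := ENNReal.toReal_mono hM hQle
  rw [poissonLaw, lintegral_sum_measure, hsub, expNeg_ofReal (sub_nonneg.2 hQ')]
  simp_rw [lintegral_smul_measure, hterm, smul_eq_mul]
  have hexp := (NormedSpace.expSeries_div_hasSum_exp Q.toReal).mul_left
    (Real.exp (-μ.real Set.univ))
  rw [← Real.exp_eq_exp_ℝ, ← Real.exp_add] at hexp
  rw [neg_sub, sub_eq_neg_add, ← hexp.tsum_eq, ENNReal.ofReal_tsum_of_nonneg _ hexp.summable]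
  · refine tsum_congr fun n => ?_
    rw [mul_div_assoc', mul_div_right_comm, ENNReal.ofReal_mul (by positivity),
      ENNReal.ofReal_pow ENNReal.toReal_nonneg, ENNReal.ofReal_toReal hQ]
  · exact fun n => by positivity

instance : IsProbabilityMeasure (poissonLaw μ) := by
  have := lintegral_laplaceVar_poissonLaw μ (g := 0) measurable_zero
  refine ⟨?_⟩
  simpa using this

end Poisson

variable {S : Type*} [MeasurableSpace S] {Pr : Measure S} {W : ℝ≥0 → S → ℝ}

/-! ### The intensity of the injected particles -/

/-- The density `λ₀ P_x(X_t = 0) + λ₁ P_x(X_t = 1)` of the injection measure. -/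
noncomputable def injectionDensity (Pr : Measure S) (W : ℝ≥0 → S → ℝ) (lam₀ lam₁ t : ℝ≥0)
    (x : ℝ) : ℝ≥0∞ :=
  lam₀ * semigroup Pr W t (Set.indicator {0} 1) x + lam₁ * semigroup Pr W t (Set.indicator {1} 1) x

namespace IsRegularBrownian

lemma measurable_indicator_singleton (a : ℝ) :
    Measurable (Set.indicator {a} 1 : ℝ → ℝ≥0∞) :=
  measurable_one.indicator (measurableSet_singleton a)

lemma measure_hitTime_le (hW : IsRegularBrownian W Pr) {a : ℝ} (ha : a ∉ Set.Ioo (0 : ℝ) 1)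
    (x : ℝ) (t : ℝ≥0) :
    Pr {s | hitTime W x a s ≤ (t : WithTop ℝ≥0)} =
      semigroup Pr W t (Set.indicator {a} 1) x := by
  have h : {s | hitTime W x a s ≤ (t : WithTop ℝ≥0)} = absorbed W x t ⁻¹' {a} := by
    ext s
    exact hitTime_le_iff (hW.continuous_path s) ha t
  rw [h, semigroup, ← lintegral_indicator_one
    (hW.measurable_absorbed_const x t (measurableSet_singleton a))]
  rfl

lemma measurable_injectionDensity (hW : IsRegularBrownian W Pr) (lam₀ lam₁ : ℝ≥0) :
    Measurable fun p : ℝ≥0 × ℝ => injectionDensity Pr W lam₀ lam₁ p.1 p.2 :=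
  ((hW.measurable_semigroup (measurable_indicator_singleton 0)).const_mul _).add
    ((hW.measurable_semigroup (measurable_indicator_singleton 1)).const_mul _)

lemma lintegral_injection (hW : IsRegularBrownian W Pr) (lam₀ lam₁ t : ℝ≥0) {f : I01 → ℝ≥0∞}
    (hf : Measurable f) :
    ∫⁻ x, f x ∂injection Pr W lam₀ lam₁ t =
      ∫⁻ x, zeroExt f x * injectionDensity Pr W lam₀ lam₁ t x := by
  have hd : Measurable fun x : ℝ => injectionDensity Pr W lam₀ lam₁ t x :=
    (hW.measurable_injectionDensity lam₀ lam₁).comp measurable_prodMk_left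
  have hinj : injection Pr W lam₀ lam₁ t = ((volume : Measure ℝ).comap ((↑) : I01 → ℝ)).withDensity
      fun x => injectionDensity Pr W lam₀ lam₁ t x := by
    simp only [injection, injectionDensity, hW.measure_hitTime_le (a := 0) (by simp),
      hW.measure_hitTime_le (a := 1) (by simp)]
  have hd' : Measurable fun x : I01 => injectionDensity Pr W lam₀ lam₁ t x :=
    hd.comp measurable_subtype_coe
  rw [hinj, lintegral_withDensity_eq_lintegral_mul _ hd' hf, lintegral_comap_coe]
  refine lintegral_congr fun x => ?_
  by_cases hx : x ∈ Set.Ioo (0 : ℝ) 1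
  · lift x to I01 using hx
    rw [zeroExt_coe, zeroExt_coe, Pi.mul_apply, mul_comm]
  · rw [zeroExt_of_notMem _ hx, zeroExt_of_notMem _ hx, zero_mul]

lemma semigroup_of_notMem (hW : IsRegularBrownian W Pr) [IsProbabilityMeasure Pr]
    (t : ℝ≥0) (F : ℝ → ℝ≥0∞) {y : ℝ} (hy : y ∉ Set.Ioo (0 : ℝ) 1) :
    semigroup Pr W t F y = F y := by
  have h (s : S) : absorbed W y t s = y := by
    have h0 := absorbed_zero (x := y) (hW.continuous_path s)
    rw [hW.zero, add_zero] at h0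
    rw [absorbed_eq_of_notMem (hW.continuous_path s) zero_le (h0.symm ▸ hy), h0]
  simp [semigroup, h]

/-- Absorption at `a` during `[0, s + t]` happens either before time `s` or, for a path that
survives up to time `s`, during the following time interval of length `t`. -/
lemma semigroup_indicator_add (hW : IsRegularBrownian W Pr) [IsProbabilityMeasure Pr] {a : ℝ}
    (ha : a ∉ Set.Ioo (0 : ℝ) 1) (s t : ℝ≥0) (x : ℝ) :
    semigroup Pr W (s + t) (Set.indicator {a} 1) x = semigroup Pr W s (Set.indicator {a} 1) x +
      semigroup Pr W s (zeroExt fun y => semigroup Pr W t (Set.indicator {a} 1) y) x := by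
  have hi := measurable_indicator_singleton a
  rw [hW.semigroup_add hi, semigroup, semigroup, semigroup,
    ← lintegral_add_left (f := fun w => Set.indicator {a} 1 (absorbed W x s w))
      (hi.comp (hW.measurable_absorbed_const x s))]
  refine lintegral_congr fun w => ?_
  by_cases h : absorbed W x s w ∈ Set.Ioo (0 : ℝ) 1
  · have hne : absorbed W x s w ∉ ({a} : Set ℝ) := fun h' => ha (h' ▸ h)
    rw [Set.indicator_of_notMem hne, zero_add]
    exact (zeroExt_coe (fun y : I01 => semigroup Pr W t (Set.indicator {a} 1) y) ⟨_, h⟩).symm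
  · rw [hW.semigroup_of_notMem t _ h, zeroExt_of_notMem _ h, add_zero]

/-- Symmetry of the killed semigroup transfers the survival up to time `s` from the absorption
probability to the test function. -/
lemma lintegral_zeroExt_mul_semigroup_indicator_add (hW : IsRegularBrownian W Pr)
    [IsProbabilityMeasure Pr] {a : ℝ} (ha : a ∉ Set.Ioo (0 : ℝ) 1) (s t : ℝ≥0)
    {f : I01 → ℝ≥0∞} (hf : Measurable f) :
    ∫⁻ x, zeroExt f x * semigroup Pr W (s + t) (Set.indicator {a} 1) x =
      (∫⁻ x, zeroExt f x * semigroup Pr W s (Set.indicator {a} 1) x) +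
      ∫⁻ x, zeroExt (fun y => semigroup Pr W s (zeroExt f) y) x *
        semigroup Pr W t (Set.indicator {a} 1) x := by
  have hi := measurable_indicator_singleton a
  have hfe := measurable_zeroExt hf
  have hk : Measurable fun y : I01 => semigroup Pr W t (Set.indicator {a} 1) (y : ℝ) :=
    (hW.measurable_semigroup_right hi t).comp measurable_subtype_coe
  simp_rw [hW.semigroup_indicator_add ha, mul_add]
  rw [lintegral_add_left
      (f := fun x => zeroExt f x * semigroup Pr W s (Set.indicator {a} 1) x)
      (hfe.mul (hW.measurable_semigroup_right hi s)),
    hW.lintegral_mul_semigroup_comm hf hk s]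
  congr 1
  refine lintegral_congr fun x => ?_
  by_cases hx : x ∈ Set.Ioo (0 : ℝ) 1
  · lift x to I01 using hx
    rw [zeroExt_coe, zeroExt_coe, mul_comm]
  · rw [zeroExt_of_notMem _ hx, zeroExt_of_notMem _ hx, zero_mul, zero_mul]

/-- The flow property `μ_{s+t} = μ_s + μ_t Q_s` of the injection measures, with `Q` the
semigroup of the killed Brownian motion. -/
lemma lintegral_injection_add (hW : IsRegularBrownian W Pr) [IsProbabilityMeasure Pr]
    (lam₀ lam₁ s t : ℝ≥0) {f : I01 → ℝ≥0∞} (hf : Measurable f) :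
    ∫⁻ x, f x ∂injection Pr W lam₀ lam₁ (s + t) = (∫⁻ x, f x ∂injection Pr W lam₀ lam₁ s) +
      ∫⁻ x, semigroup Pr W s (zeroExt f) x ∂injection Pr W lam₀ lam₁ t := by
  have hfe := measurable_zeroExt hf
  have hk : Measurable fun y : I01 => semigroup Pr W s (zeroExt f) (y : ℝ) :=
    (hW.measurable_semigroup_right hfe s).comp measurable_subtype_coe
  have hi (a : ℝ) (t : ℝ≥0) : Measurable (semigroup Pr W t (Set.indicator {a} 1)) :=
    hW.measurable_semigroup_right (measurable_indicator_singleton a) t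
  have hsplit (t : ℝ≥0) {f : I01 → ℝ≥0∞} (hf : Measurable f) :
      ∫⁻ x, f x ∂injection Pr W lam₀ lam₁ t =
        lam₀ * (∫⁻ x, zeroExt f x * semigroup Pr W t (Set.indicator {0} 1) x) +
        lam₁ * ∫⁻ x, zeroExt f x * semigroup Pr W t (Set.indicator {1} 1) x := by
    have hfe := measurable_zeroExt hf
    have hm (a : ℝ) : Measurable fun x =>
        zeroExt f x * semigroup Pr W t (Set.indicator {a} 1) x := hfe.mul (hi a t)
    rw [hW.lintegral_injection lam₀ lam₁ t hf, ← lintegral_const_mul _ (hm 0),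
      ← lintegral_const_mul _ (hm 1), ← lintegral_add_left ((hm 0).const_mul _)]
    refine lintegral_congr fun x => ?_
    rw [injectionDensity]
    ring
  rw [hsplit _ hf, hsplit _ hf, hsplit _ hk,
    hW.lintegral_zeroExt_mul_semigroup_indicator_add (a := 0) (by simp) s t hf,
    hW.lintegral_zeroExt_mul_semigroup_indicator_add (a := 1) (by simp) s t hf]
  ring

end IsRegularBrownian
end BrownianGas

namespace BrownianGas

open Filter Topology BrownianGas.Configuration

variable {S : Type*} [MeasurableSpace S] {Pr : Measure S} {W : ℝ≥0 → S → ℝ}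

namespace IsRegularBrownian

/-! ### The transition function of the boundary driven gas -/

lemma isProbabilityMeasure_gasLaw (hW : IsRegularBrownian W Pr) [IsProbabilityMeasure Pr]
    (lam₀ lam₁ t : ℝ≥0) (ω : Configuration) :
    IsProbabilityMeasure (gasLaw Pr W lam₀ lam₁ t ω) := by
  have := hW.isProbabilityMeasure_freeLaw t ω
  exact Measure.isProbabilityMeasure_map Configuration.measurable_add.aemeasurable

/-- The Laplace functional of the law of the boundary driven gas. -/
lemma lintegral_laplaceVar_gasLaw (hW : IsRegularBrownian W Pr) [IsProbabilityMeasure Pr]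
    (lam₀ lam₁ t : ℝ≥0) (ω : Configuration) {g : I01 → ℝ≥0∞} (hg : Measurable g) :
    ∫⁻ η, laplaceVar g η ∂gasLaw Pr W lam₀ lam₁ t ω =
      expNeg (∫⁻ x, (1 - expNeg (g x)) ∂injection Pr W lam₀ lam₁ t) *
        laplaceVar (evolve Pr W t g) ω := by
  have := hW.isProbabilityMeasure_freeLaw t ω
  have hm := measurable_laplaceVar hg
  rw [gasLaw, lintegral_map hm Configuration.measurable_add]
  simp_rw [laplaceVar_add_configuration]
  rw [lintegral_prod_mul hm.aemeasurable hm.aemeasurable, lintegral_laplaceVar_poissonLaw _ hg,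
    hW.lintegral_laplaceVar_freeLaw t ω hg]

lemma measurable_one_sub_expNeg {g : I01 → ℝ≥0∞} (hg : Measurable g) :
    Measurable fun x => 1 - expNeg (g x) :=
  measurable_const.sub (measurable_expNeg.comp hg)

lemma measurable_gasLaw (hW : IsRegularBrownian W Pr) [IsProbabilityMeasure Pr]
    (lam₀ lam₁ : ℝ≥0) :
    Measurable fun p : ℝ≥0 × Configuration => gasLaw Pr W lam₀ lam₁ p.1 p.2 := by
  have := fun p : ℝ≥0 × Configuration => hW.isProbabilityMeasure_gasLaw lam₀ lam₁ p.1 p.2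
  refine measurable_of_laplace fun g hg => ?_
  simp_rw [hW.lintegral_laplaceVar_gasLaw lam₀ lam₁ _ _ hg,
    hW.lintegral_injection lam₀ lam₁ _ (measurable_one_sub_expNeg hg)]
  have h1 : Measurable fun p : ℝ≥0 × ℝ => zeroExt (fun x => 1 - expNeg (g x)) p.2 *
      injectionDensity Pr W lam₀ lam₁ p.1 p.2 :=
    ((measurable_zeroExt (measurable_one_sub_expNeg hg)).comp measurable_snd).mul
      (hW.measurable_injectionDensity lam₀ lam₁)
  have h2 : Measurable fun t : ℝ≥0 => ∫⁻ x, zeroExt (fun x => 1 - expNeg (g x)) x *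
      injectionDensity Pr W lam₀ lam₁ t x := h1.lintegral_prod_right'
  have h3 : Measurable fun p : ℝ≥0 × Configuration => laplaceVar (evolve Pr W p.1 g) p.2 :=
    measurable_expNeg.comp
      (measurable_lintegral_param (f := fun t x => evolve Pr W t g x) (hW.measurable_evolve hg))
  exact (measurable_expNeg.comp (h2.comp measurable_fst)).mul h3

lemma measurable_gasLaw_right (hW : IsRegularBrownian W Pr) [IsProbabilityMeasure Pr]
    (lam₀ lam₁ t : ℝ≥0) : Measurable (gasLaw Pr W lam₀ lam₁ t) := by
  have h : Measurable fun ω : Configuration => (t, ω) := measurable_prodMk_left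
  have h2 := (hW.measurable_gasLaw lam₀ lam₁).comp h
  exact h2

lemma gasLaw_zero (hW : IsRegularBrownian W Pr) [IsProbabilityMeasure Pr] (lam₀ lam₁ : ℝ≥0)
    (ω : Configuration) : gasLaw Pr W lam₀ lam₁ 0 ω = Measure.dirac ω := by
  have := hW.isProbabilityMeasure_gasLaw lam₀ lam₁ 0 ω
  have h0 (x : ℝ) (s : S) : absorbed W x 0 s = x := by
    rw [absorbed_zero (hW.continuous_path s), hW.zero, add_zero]
  have hsg (F : ℝ → ℝ≥0∞) (x : ℝ) : semigroup Pr W 0 F x = F x := by simp [semigroup, h0]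
  refine ext_of_laplace fun g hg => ?_
  rw [hW.lintegral_laplaceVar_gasLaw lam₀ lam₁ 0 ω hg, lintegral_dirac' _ (measurable_laplaceVar hg),
    hW.lintegral_injection lam₀ lam₁ 0 (measurable_one_sub_expNeg hg)]
  have h1 (x : ℝ) : zeroExt (fun x => 1 - expNeg (g x)) x *
      injectionDensity Pr W lam₀ lam₁ 0 x = 0 := by
    by_cases hx : x ∈ Set.Ioo (0 : ℝ) 1
    · simp [injectionDensity, hsg, hx.1.ne', hx.2.ne]
    · rw [zeroExt_of_notMem _ hx, zero_mul]
  have h2 : evolve Pr W 0 g = g := by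
    ext x
    rw [evolve, hsg, zeroExt_coe, negLog_expNeg]
  simp [h1, h2]

lemma evolve_add (hW : IsRegularBrownian W Pr) [IsProbabilityMeasure Pr] (s t : ℝ≥0)
    {g : I01 → ℝ≥0∞} (hg : Measurable g) :
    evolve Pr W (s + t) g = evolve Pr W s (evolve Pr W t g) := by
  ext x
  -- The identity `T_t e^{-g} = e^{-V_t g}` must hold on all of `ℝ` for the semigroup property to
  -- apply; outside `(0,1)` points are fixed and both sides equal `1`.
  have h (y : ℝ) : semigroup Pr W t (fun y => expNeg (zeroExt g y)) y =
      expNeg (zeroExt (evolve Pr W t g) y) := by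
    by_cases hy : y ∈ Set.Ioo (0 : ℝ) 1
    · lift y to I01 using hy
      rw [zeroExt_coe, expNeg_evolve]
    · rw [hW.semigroup_of_notMem t _ hy, zeroExt_of_notMem _ hy, zeroExt_of_notMem _ hy]
  rw [evolve, hW.semigroup_add (measurable_expNeg_zeroExt hg), funext h, evolve]

/-- As `Pr` has mass `1`, the complement passes under the expectation. The function `1 - e^{-g}`
vanishes off `(0,1)`, so absorbed particles drop out and the linear killed semigroup appears. -/
lemma one_sub_expNeg_evolve (hW : IsRegularBrownian W Pr) [IsProbabilityMeasure Pr] (t : ℝ≥0)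
    {g : I01 → ℝ≥0∞} (hg : Measurable g) (x : I01) :
    1 - expNeg (evolve Pr W t g x) = semigroup Pr W t (zeroExt fun y => 1 - expNeg (g y)) x := by
  have hm : Measurable fun s => expNeg (zeroExt g (absorbed W x t s)) :=
    (measurable_expNeg_zeroExt hg).comp (hW.measurable_absorbed_const x t)
  have hle : ∫⁻ s, expNeg (zeroExt g (absorbed W x t s)) ∂Pr ≤ 1 :=
    (lintegral_mono fun _ => expNeg_le_one _).trans (by simp)
  have h1 : (1 : ℝ≥0∞) = ∫⁻ _, 1 ∂Pr := by simp
  rw [expNeg_evolve, semigroup, semigroup, h1, ← lintegral_sub hm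
    (ne_top_of_le_ne_top (by simp) hle) (ae_of_all _ fun _ => expNeg_le_one _)]
  refine lintegral_congr fun s => ?_
  by_cases hy : absorbed W x t s ∈ Set.Ioo (0 : ℝ) 1
  · have h (f : I01 → ℝ≥0∞) : zeroExt f (absorbed W x t s) = f ⟨_, hy⟩ := zeroExt_coe f ⟨_, hy⟩
    rw [h, h]
    simp
  · rw [zeroExt_of_notMem _ hy, zeroExt_of_notMem _ hy]
    simp

/-- The Chapman-Kolmogorov equation for the boundary driven gas. -/
lemma gasLaw_add (hW : IsRegularBrownian W Pr) [IsProbabilityMeasure Pr] (lam₀ lam₁ s t : ℝ≥0)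
    (ω : Configuration) :
    gasLaw Pr W lam₀ lam₁ (s + t) ω =
      (gasLaw Pr W lam₀ lam₁ s ω).bind (gasLaw Pr W lam₀ lam₁ t) := by
  have hprob := hW.isProbabilityMeasure_gasLaw lam₀ lam₁
  have := hprob s ω
  have := hprob (s + t) ω
  have hmeas : Measurable (gasLaw Pr W lam₀ lam₁ t) :=
    hW.measurable_gasLaw_right lam₀ lam₁ t
  have : IsProbabilityMeasure ((gasLaw Pr W lam₀ lam₁ s ω).bind (gasLaw Pr W lam₀ lam₁ t)) :=
    ⟨by simp [Measure.bind_apply .univ hmeas.aemeasurable, (hprob t _).measure_univ]⟩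
  refine ext_of_laplace fun g hg => ?_
  have hV := hW.measurable_evolve_right hg t
  have hf := measurable_one_sub_expNeg hg
  rw [Measure.lintegral_bind hmeas.aemeasurable (measurable_laplaceVar hg).aemeasurable]
  simp_rw [hW.lintegral_laplaceVar_gasLaw lam₀ lam₁ _ _ hg]
  rw [lintegral_const_mul _ (measurable_laplaceVar hV),
    hW.lintegral_laplaceVar_gasLaw lam₀ lam₁ _ _ hV, ← mul_assoc, ← expNeg_add,
    hW.evolve_add s t hg]
  simp_rw [hW.one_sub_expNeg_evolve t hg]
  -- For `f = 1 - e^{-g}` the exponent is now `μ_t(f) + μ_s(Q_t f)`: particles injected in the first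
  -- period `s` evolve for a further time `t`.
  rw [← hW.lintegral_injection_add lam₀ lam₁ t s hf, add_comm t s]

lemma isTransitionFunction_gasLaw (hW : IsRegularBrownian W Pr) [IsProbabilityMeasure Pr]
    (lam₀ lam₁ : ℝ≥0) : IsTransitionFunction (gasLaw Pr W lam₀ lam₁) where
  isProbabilityMeasure := hW.isProbabilityMeasure_gasLaw lam₀ lam₁
  zero := hW.gasLaw_zero lam₀ lam₁
  measurable B hB := (Measure.measurable_coe hB).comp (hW.measurable_gasLaw lam₀ lam₁)
  chapmanKolmogorov s t ω B hB := by
    rw [hW.gasLaw_add, Measure.bind_apply hB (hW.measurable_gasLaw_right lam₀ lam₁ t).aemeasurable]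

end IsRegularBrownian

end BrownianGas

theorem lemma2p1 {S : Type*} [MeasurableSpace S] (Pr : Measure S) [IsProbabilityMeasure Pr]
    (W : ℝ≥0 → S → ℝ) (hW : IsBrownianReal W Pr) (lam₀ lam₁ : ℝ≥0) :
    BrownianGas.IsTransitionFunction (BrownianGas.gasLaw Pr W lam₀ lam₁) := by
  obtain ⟨W', hW', hae⟩ := BrownianGas.exists_isRegularBrownian hW
  rw [BrownianGas.gasLaw_congr hae]
  exact hW'.isTransitionFunction_gasLaw lam₀ lam₁
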